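/- Let $F$ be a non-Archimedean local field of odd residue characteristic, let $D_F$ be the quaternion division algebra with center $F$ (that is, a central division algebra of dimension $4$ over $F$), and give the unit group $D_F^\times$ its natural topology as a topological group. Let $H^2$ denote continuous cohomology with trivial action of $D_F^\times$ on the coefficients, where $\mathbb{Z}/2\mathbb{Z}$ is discrete and $\mathbb{C}^\times$ has its usual topology. Then: (A) there is an isomorphism of groups $H^2(D_F^\times, \mathbb{Z}/2\mathbb{Z}) \cong \mathbb{Z}/2\mathbb{Z} \oplus \mathbb{Z}/2\mathbb{Z}$; (B) the subgroup $H^2(D_F^\times, \mathbb{C}^\times)[2] = \{a \in H^2(D_F^\times, \mathbb{C}^\times) : 2a = 0\}$ is isomorphic to $\mathbb{Z}/2\mathbb{Z}$. -/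

import Mathlib

open scoped ValuativeRel

universe v

/-- The universe lift of a topological additive group is a topological additive group. -/
instance ULift.isTopologicalAddGroup_of_type {A : Type} [AddCommGroup A] [TopologicalSpace A]
    [IsTopologicalAddGroup A] : IsTopologicalAddGroup (ULift.{v} A) where
  continuous_add := continuous_uliftUp.comp
    ((continuous_uliftDown.comp continuous_fst).add (continuous_uliftDown.comp continuous_snd))
  continuous_neg := continuous_uliftUp.comp continuous_uliftDown.neg

/-- The continuous cohomology group `H²(G, A)` of a topological group `G` with coefficients in a
topological abelian group `A` (written additively) on which `G` acts trivially. The lift of `A` to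
the universe of `G` only serves to fit the universe levels of `continuousCohomology`. -/
noncomputable abbrev contH2 (G : Type v) [Group G] [TopologicalSpace G] [IsTopologicalGroup G]
    (A : Type) [AddCommGroup A] [TopologicalSpace A] [IsTopologicalAddGroup A] : TopModuleCat ℤ :=
  continuousCohomology.{0, v, v} 2
    (TopRep.of (ContRepresentation.trivial ℤ G (ULift.{v} A)))

/-! Let N be the group of principal units of D. It is compact, open and normal in `Dˣ`, and it is
pro-odd because 2 is a unit. The quotient `Dˣ`/N is an extension of ℤ (the normalised valuation) by
the units of the residue ring, which form a finite cyclic group of even order n. Hence it is a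
semidirect product ℤ/n ⋊ ℤ (`exists_units_hom_cyclicByInt`). Of n and r, only the evenness of n
matters below. The valuation is that of the norm from D to F; its ultrametric inequality follows
from boundedness of powers (`normVal_one_add_le`).

Averaging over N modulo 2 shows that every continuous ℤ/2-cocycle is cohomologous to an inflated one
(`exists_eq_inflation_add_coboundary`). An inflated cocycle killed by 2 becomes trivial only if it
already was, because continuous homomorphisms from N to a group without small subgroups have odd
exponent (`isTwoCoboundary_of_inflation`). This reduces the problem to the discrete quotient.

There the presentation ⟨Z, W | Z^n = 1, WZ = Z^R W⟩ decides: the failure of the two relations for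
lifts to a central extension is a pair in A × A, and changing the lift of Z moves it by a pair (nz,
z − Rz) (`isTwoCoboundary_iff`). For A = ℤ/2 there is no ambiguity, as n is even and R odd, and all
pairs occur (`exists_cocycle`); this gives (A).

For (B), continuous square roots (`exists_continuous_half`) bring every 2-torsion class from a
cocycle with values ±1. Write n = d n' and R − 1 = d r' with n', r' coprime. Since ℂˣ is divisible,
a pair of signs becomes trivial exactly on the line spanned by (n', r') modulo 2
(`exists_signChar_eq_nsmul_iff`), and the quotient of (ℤ/2)² by a line is ℤ/2. -/

/-! ### Degree-two continuous cohomology through inhomogeneous cocycles -/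

open CategoryTheory in
/-- The homology of a cochain complex of topological modules in positive degree is the quotient of
the cocycles by the coboundaries. -/
theorem exists_cocycles_to_homology {R : Type*} [Ring R] [TopologicalSpace R]
    (K : CochainComplex (TopModuleCat.{v} R) ℕ) (i : ℕ) :
    ∃ p : (K.d (i + 1) (i + 2)).hom.ker →ₗ[R] K.homology (i + 1), Function.Surjective p ∧
      ∀ x, p x = 0 ↔ ∃ y : K.X i, (K.d i (i + 1)).hom y = x.1 := by
  -- Uniqueness of limits and colimits identifies the abstract cycles and homology with the concrete
  -- kernel and cokernel of topological modules.
  let e : TopModuleCat.ker (K.d (i + 1) (i + 2)) ≅ K.cycles (i + 1) :=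
    (TopModuleCat.isLimitKer _).conePointUniqueUpToIso
      (K.cyclesIsKernel (i + 1) (i + 2) (by simp))
  have he : e.hom ≫ K.iCycles (i + 1) = TopModuleCat.kerι _ :=
    Limits.IsLimit.conePointUniqueUpToIso_hom_comp _ _ Limits.WalkingParallelPair.zero
  let f : TopModuleCat.coker (K.toCycles i (i + 1)) ≅ K.homology (i + 1) :=
    (TopModuleCat.isColimitCoker _).coconePointUniqueUpToIso
      (K.homologyIsCokernel i (i + 1) (by simp))
  have hf : TopModuleCat.cokerπ _ ≫ f.hom = K.homologyπ (i + 1) :=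
    Limits.IsColimit.comp_coconePointUniqueUpToIso_hom (TopModuleCat.isColimitCoker _)
      (K.homologyIsCokernel i (i + 1) (by simp)) Limits.WalkingParallelPair.one
  have hfe : ∀ x, (K.homologyπ (i + 1)).hom x = f.hom.hom ((TopModuleCat.cokerπ _).hom x) :=
    fun x => by rw [← hf]; rfl
  have hei : ∀ x, (K.iCycles (i + 1)).hom (e.hom.hom x) = x.1 := fun x =>
    congr(TopModuleCat.Hom.hom $he x)
  have finj : Function.Injective f.hom.hom := (ConcreteCategory.bijective_of_isIso f.hom).1
  have fsurj : Function.Surjective f.hom.hom := (ConcreteCategory.bijective_of_isIso f.hom).2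
  have esurj : Function.Surjective e.hom.hom := (ConcreteCategory.bijective_of_isIso e.hom).2
  have einj : Function.Injective e.hom.hom := (ConcreteCategory.bijective_of_isIso e.hom).1
  have iinj : Function.Injective (K.iCycles (i + 1)).hom := fun a b h => by
    obtain ⟨a, rfl⟩ := esurj a
    obtain ⟨b, rfl⟩ := esurj b
    rw [hei, hei] at h
    rw [Subtype.ext h]
  have hd : ∀ y, (K.iCycles (i + 1)).hom ((K.toCycles i (i + 1)).hom y) = (K.d i (i + 1)).hom y :=
    fun y => congr(TopModuleCat.Hom.hom $(K.toCycles_i i (i + 1)) y)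
  refine ⟨(K.homologyπ (i + 1)).hom.toLinearMap ∘ₗ e.hom.hom.toLinearMap, fun x => ?_, fun x => ?_⟩
  · obtain ⟨x, rfl⟩ := fsurj x
    obtain ⟨x, rfl⟩ := TopModuleCat.cokerπ_surjective _ x
    obtain ⟨x, rfl⟩ := esurj x
    exact ⟨x, hfe _⟩
  · change (K.homologyπ (i + 1)).hom (e.hom.hom x) = 0 ↔ _
    rw [hfe, map_eq_zero_iff _ finj, TopModuleCat.hom_cokerπ, Submodule.mkQ_apply,
      Submodule.Quotient.mk_eq_zero]
    constructor
    · rintro ⟨y, hy⟩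
      refine ⟨y, ?_⟩
      rw [← hd, ← hei x]
      exact congrArg _ hy
    · rintro ⟨y, hy⟩
      refine ⟨y, iinj ?_⟩
      rw [hei, ← hy]
      exact hd y

section Cocycles

variable (G : Type*) [Group G] [TopologicalSpace G] [IsTopologicalGroup G]
  (A : Type*) [AddCommGroup A] [TopologicalSpace A] [IsTopologicalAddGroup A]

/-- Continuous inhomogeneous 2-cocycles with trivial action on the coefficients. -/
def contZ2 : AddSubgroup C(G × G, A) where
  carrier := {c | ∀ g h k, c (h, k) + c (g, h * k) = c (g * h, k) + c (g, h)}
  zero_mem' := by simp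
  add_mem' {a b} ha hb g h k := by
    have := congr($(ha g h k) + $(hb g h k))
    simp only [ContinuousMap.add_apply]
    abel_nf at this ⊢
    exact this
  neg_mem' {a} ha g h k := by
    have := congr(-$(ha g h k))
    simp only [ContinuousMap.neg_apply]
    abel_nf at this ⊢
    exact this

end Cocycles

section Comparison

open TopRep ContRepresentation CategoryTheory

variable {G : Type v} [Group G] [TopologicalSpace G] [IsTopologicalGroup G]
  {A : Type} [AddCommGroup A] [TopologicalSpace A] [IsTopologicalAddGroup A]

variable (G A) in
/-- The trivial representation on (a lift of) `A`. -/
noncomputable abbrev trivRep : TopRep ℤ G :=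
  TopRep.of (ContRepresentation.trivial ℤ G (ULift.{v} A))

theorem homogeneousCochains_d_one_two (σ : (homogeneousCochains (trivRep G A)).X 1) (x y z : G) :
    (((homogeneousCochains (trivRep G A)).d 1 2).hom σ).1 x y z =
      σ.1 y z - σ.1 x z + σ.1 x y := by
  rw [homogeneousCochains.d_apply]
  change σ.1 y z - (σ.1 x z - σ.1 x y) = _
  abel

theorem homogeneousCochains_d_two_three (σ : (homogeneousCochains (trivRep G A)).X 2)
    (w x y z : G) :
    (((homogeneousCochains (trivRep G A)).d 2 3).hom σ).1 w x y z =
      σ.1 x y z - σ.1 w y z + σ.1 w x z - σ.1 w x y := by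
  rw [homogeneousCochains.d_apply]
  change σ.1 x y z - (σ.1 w y z - (σ.1 w x z - σ.1 w x y)) = _
  abel

/-- The homogeneous cochain attached to an inhomogeneous one. -/
def toHomogeneousTwo (c : C(G × G, A)) : (homogeneousCochains (trivRep G A)).X 2 :=
  ⟨(ContinuousMap.mk (fun p : (G × G) × G => ULift.up (c (p.1.1⁻¹ * p.1.2, p.1.2⁻¹ * p.2)))
    (continuous_uliftUp.comp (by fun_prop))).curry.curry, fun g => by
      ext x y z
      change c ((g⁻¹ * x)⁻¹ * (g⁻¹ * y), (g⁻¹ * y)⁻¹ * (g⁻¹ * z)) = c (x⁻¹ * y, y⁻¹ * z)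
      congr 2 <;> group⟩

/-- The homogeneous 1-cochain attached to an inhomogeneous one. -/
def toHomogeneousOne (b : C(G, A)) : (homogeneousCochains (trivRep G A)).X 1 :=
  ⟨(ContinuousMap.mk (fun p : G × G => ULift.up (b (p.1⁻¹ * p.2)))
    (continuous_uliftUp.comp (by fun_prop))).curry, fun g => by
      ext x y
      change b ((g⁻¹ * x)⁻¹ * (g⁻¹ * y)) = b (x⁻¹ * y)
      congr 1; group⟩

/-- Invariance determines a cochain from its values with first argument 1. Local compactness makes
evaluation jointly continuous, so that a curried cochain becomes a continuous function of two
variables. -/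
theorem toHomogeneousTwo_surjective [LocallyCompactSpace G] :
    Function.Surjective (toHomogeneousTwo : C(G × G, A) → _) := fun σ => by
  let τ : C(G, C(G, C(G, ULift.{v} A))) := σ.1
  refine ⟨⟨fun p => (τ 1 p.1 (p.1 * p.2)).down, continuous_uliftDown.comp ?_⟩, ?_⟩
  · exact (ContinuousEval.continuous_eval (F := C(G, ULift.{v} A))).comp
      ((((τ 1).continuous.comp continuous_fst)).prodMk (by fun_prop))
  · refine Subtype.ext (ContinuousMap.ext fun x => ContinuousMap.ext fun y =>
      ContinuousMap.ext fun z => ?_)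
    have : τ (x * 1) (x * (x⁻¹ * y)) (x * (x⁻¹ * y * (y⁻¹ * z))) =
        τ 1 (x⁻¹ * y) (x⁻¹ * y * (y⁻¹ * z)) := by
      have := congr($(σ.2 x⁻¹) 1 (x⁻¹ * y) (x⁻¹ * y * (y⁻¹ * z)))
      change τ (x⁻¹⁻¹ * _) (x⁻¹⁻¹ * _) (x⁻¹⁻¹ * _) = _ at this
      rw [inv_inv] at this
      exact this
    change τ 1 _ _ = τ x y z
    refine this.symm.trans ?_
    simp [← mul_assoc]

theorem toHomogeneousOne_surjective :
    Function.Surjective (toHomogeneousOne : C(G, A) → _) := fun σ => by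
  let τ : C(G, C(G, ULift.{v} A)) := σ.1
  refine ⟨⟨fun p => (τ 1 p).down, continuous_uliftDown.comp (τ 1).continuous⟩, ?_⟩
  refine Subtype.ext (ContinuousMap.ext fun x => ContinuousMap.ext fun y => ?_)
  have : τ (x * 1) (x * (x⁻¹ * y)) = τ 1 (x⁻¹ * y) := by
    have := congr($(σ.2 x⁻¹) 1 (x⁻¹ * y))
    change τ (x⁻¹⁻¹ * _) (x⁻¹⁻¹ * _) = _ at this
    rw [inv_inv] at this
    exact this
  change τ 1 _ = τ x y
  refine this.symm.trans ?_
  simp [← mul_assoc]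

theorem d_toHomogeneousTwo_eq_zero_iff (c : C(G × G, A)) :
    ((homogeneousCochains (trivRep G A)).d 2 3).hom (toHomogeneousTwo c) = 0 ↔
      c ∈ contZ2 G A := by
  constructor
  · intro h x y z
    -- The successive quotients of this simplex are x, y, z.
    have h1 := homogeneousCochains_d_two_three (toHomogeneousTwo c) 1 x (x * y) (x * y * z)
    rw [h] at h1
    replace h1 := congr(ULift.down $h1)
    change 0 = c _ - c _ + c _ - c _ at h1
    simp only [inv_mul_cancel_left, inv_one, one_mul, mul_assoc, mul_inv_rev] at h1
    rw [eq_comm, sub_eq_zero] at h1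
    rw [← h1]
    abel
  · intro h
    refine Subtype.ext (ContinuousMap.ext fun w => ContinuousMap.ext fun x =>
      ContinuousMap.ext fun y => ContinuousMap.ext fun z => ?_)
    refine (homogeneousCochains_d_two_three (toHomogeneousTwo c) w x y z).trans ?_
    apply ULift.down_injective
    change c _ - c _ + c _ - c _ = 0
    have := h (w⁻¹ * x) (x⁻¹ * y) (y⁻¹ * z)
    simp only [mul_assoc, mul_inv_cancel_left] at this
    rw [sub_eq_zero, sub_add_eq_add_sub, this]
    abel

theorem d_toHomogeneousOne (b : C(G, A)) (c : C(G × G, A)) :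
    ((homogeneousCochains (trivRep G A)).d 1 2).hom (toHomogeneousOne b) = toHomogeneousTwo c ↔
      ∀ g h, c (g, h) = b g + b h - b (g * h) := by
  constructor
  · intro h x y
    have h1 := homogeneousCochains_d_one_two (toHomogeneousOne b) 1 x (x * y)
    rw [h] at h1
    replace h1 := congr(ULift.down $h1)
    change c _ = b _ - b _ + b _ at h1
    simp only [inv_mul_cancel_left, inv_one, one_mul] at h1
    rw [h1]
    abel
  · intro h
    refine Subtype.ext (ContinuousMap.ext fun x =>
      ContinuousMap.ext fun y => ContinuousMap.ext fun z => ?_)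
    refine (homogeneousCochains_d_one_two (toHomogeneousOne b) x y z).trans ?_
    apply ULift.down_injective
    change b _ - b _ + b _ = c _
    rw [h]
    simp only [mul_assoc, mul_inv_cancel_left]
    abel

variable (G A) in
/-- For a locally compact group, continuous cohomology in degree two is the group of continuous
2-cocycles modulo the coboundaries of continuous 1-cochains. -/
theorem exists_contZ2_to_contH2 [LocallyCompactSpace G] :
    ∃ p : contZ2 G A →+ contH2 G A, Function.Surjective p ∧
      ∀ c, p c = 0 ↔ ∃ b : C(G, A), ∀ g h, c.1 (g, h) = b g + b h - b (g * h) := by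
  obtain ⟨p, hp, hp'⟩ := exists_cocycles_to_homology (homogeneousCochains (trivRep G A)) 1
  let q : contZ2 G A →+ ((homogeneousCochains (trivRep G A)).d 2 3).hom.ker :=
    { toFun c := ⟨toHomogeneousTwo c.1, (d_toHomogeneousTwo_eq_zero_iff c.1).2 c.2⟩
      map_zero' := rfl
      map_add' _ _ := rfl }
  refine ⟨p.toAddMonoidHom.comp q, hp.comp fun x => ?_, fun c => (hp' (q c)).trans ?_⟩
  · obtain ⟨c, hc⟩ := toHomogeneousTwo_surjective x.1
    refine ⟨⟨c, (d_toHomogeneousTwo_eq_zero_iff c).1 ?_⟩, Subtype.ext hc⟩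
    rw [hc]
    exact x.2
  · constructor
    · rintro ⟨y, hy⟩
      obtain ⟨b, rfl⟩ := toHomogeneousOne_surjective y
      exact ⟨b, (d_toHomogeneousOne b c.1).1 hy⟩
    · rintro ⟨b, hb⟩
      exact ⟨toHomogeneousOne b, (d_toHomogeneousOne b c.1).2 hb⟩

end Comparison

/-! ### Central extensions attached to 2-cocycles -/

section CentralExtension

variable {Q A : Type*} [Group Q] [AddCommGroup A]

/-- Inhomogeneous 2-cocycles with trivial action on the coefficients. -/
def IsTwoCocycle (c : Q → Q → A) : Prop :=
  ∀ g h k, c h k + c g (h * k) = c (g * h) k + c g h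

/-- `c` is the coboundary of a 1-cochain. -/
def IsTwoCoboundary (c : Q → Q → A) : Prop :=
  ∃ b : Q → A, ∀ g h, c g h = b g + b h - b (g * h)

theorem IsTwoCocycle.one_left {c : Q → Q → A} (hc : IsTwoCocycle c) (g : Q) : c 1 g = c 1 1 := by
  simpa using hc 1 1 g

theorem IsTwoCocycle.one_right {c : Q → Q → A} (hc : IsTwoCocycle c) (g : Q) : c g 1 = c 1 1 := by
  simpa using (hc g 1 1).symm

/-- The central extension defined by a 2-cocycle. -/
@[ext]
structure CentralExtension {c : Q → Q → A} (hc : IsTwoCocycle c) where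
  /-- The component in the coefficients. -/
  fst : A
  /-- The component in the quotient. -/
  snd : Q

namespace CentralExtension

variable {c : Q → Q → A} {hc : IsTwoCocycle c}

instance : Mul (CentralExtension hc) := ⟨fun x y => ⟨x.1 + y.1 + c x.2 y.2, x.2 * y.2⟩⟩
instance : One (CentralExtension hc) := ⟨⟨-c 1 1, 1⟩⟩
instance : Inv (CentralExtension hc) := ⟨fun x => ⟨-x.1 - c x.2⁻¹ x.2 - c 1 1, x.2⁻¹⟩⟩

@[simp] theorem mul_fst (x y : CentralExtension hc) : (x * y).1 = x.1 + y.1 + c x.2 y.2 := rfl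
@[simp] theorem mul_snd (x y : CentralExtension hc) : (x * y).2 = x.2 * y.2 := rfl
@[simp] theorem one_fst : (1 : CentralExtension hc).1 = -c 1 1 := rfl
@[simp] theorem one_snd : (1 : CentralExtension hc).2 = 1 := rfl
@[simp] theorem inv_fst (x : CentralExtension hc) : x⁻¹.1 = -x.1 - c x.2⁻¹ x.2 - c 1 1 := rfl
@[simp] theorem inv_snd (x : CentralExtension hc) : x⁻¹.2 = x.2⁻¹ := rfl

instance : Group (CentralExtension hc) :=
  Group.ofLeftAxioms
    (fun x y z => by
      ext
      · have := hc x.2 y.2 z.2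
        simp only [mul_fst, mul_snd]
        rw [add_assoc (x.1 + y.1), add_comm (c x.2 y.2), ← sub_eq_zero] at *
        rw [← sub_eq_zero] at this
        rw [← neg_eq_zero, ← this]
        abel
      · simp [mul_assoc])
    (fun x => by ext <;> simp [hc.one_left])
    (fun x => by ext <;> simp; abel)

variable (hc) in
/-- The projection of a central extension onto the quotient. -/
def proj : CentralExtension hc →* Q where
  toFun := snd
  map_one' := rfl
  map_mul' _ _ := rfl

/-- A homomorphic section of the central extension trivialises the cocycle. -/
theorem isTwoCoboundary_of_section (s : Q →* CentralExtension hc) (hs : ∀ g, (s g).2 = g) :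
    IsTwoCoboundary c := by
  refine ⟨fun g => -(s g).1, fun g h => ?_⟩
  have := congr(($(s.map_mul g h)).1)
  rw [mul_fst, hs, hs] at this
  simp only [this]
  abel

/-- Powers of a lift produce the sums of cocycle values from which the invariants below are built.
-/
theorem pow_eq (x : A) (g : Q) (k : ℕ) :
    (⟨x, g⟩ ^ k : CentralExtension hc) =
      ⟨k • x - c 1 1 + ∑ i ∈ Finset.range k, c (g ^ i) g, g ^ k⟩ := by
  induction k with
  | zero => ext <;> simp
  | succ k ih =>
    rw [pow_succ, ih, Finset.sum_range_succ]
    ext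
    · simp only [mul_fst, succ_nsmul]; abel
    · simp [pow_succ]

end CentralExtension

end CentralExtension

/-! ### The groups ℤ/n ⋊ ℤ and their 2-cocycles -/

/-- The semidirect product of `ℤ` acting on `ZMod n` by powers of the unit `r`. -/
@[ext]
structure CyclicByInt (n : ℕ) (r : (ZMod n)ˣ) where
  /-- The component in the cyclic normal subgroup. -/
  e : ZMod n
  /-- The component in the infinite cyclic quotient. -/
  v : ℤ

namespace CyclicByInt

variable {n : ℕ} {r : (ZMod n)ˣ}

instance : Mul (CyclicByInt n r) := ⟨fun x y => ⟨x.e + ↑(r ^ x.v) * y.e, x.v + y.v⟩⟩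
instance : One (CyclicByInt n r) := ⟨⟨0, 0⟩⟩
instance : Inv (CyclicByInt n r) := ⟨fun x => ⟨-(↑(r ^ (-x.v)) * x.e), -x.v⟩⟩

@[simp] theorem mul_e (x y : CyclicByInt n r) : (x * y).e = x.e + ↑(r ^ x.v) * y.e := rfl
@[simp] theorem mul_v (x y : CyclicByInt n r) : (x * y).v = x.v + y.v := rfl
@[simp] theorem one_e : (1 : CyclicByInt n r).e = 0 := rfl
@[simp] theorem one_v : (1 : CyclicByInt n r).v = 0 := rfl
@[simp] theorem inv_e (x : CyclicByInt n r) : x⁻¹.e = -(↑(r ^ (-x.v)) * x.e) := rfl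
@[simp] theorem inv_v (x : CyclicByInt n r) : x⁻¹.v = -x.v := rfl

instance : Group (CyclicByInt n r) :=
  Group.ofLeftAxioms
    (fun x y z => by
      ext
      · simp only [mul_e, mul_v, zpow_add, Units.val_mul]; ring
      · simp [add_assoc])
    (fun x => by ext <;> simp)
    (fun x => by ext <;> simp)

variable (n r) in
/-- The generator of the cyclic normal subgroup. -/
def ζ : CyclicByInt n r := ⟨1, 0⟩

variable (n r) in
/-- The generator of the infinite cyclic complement. -/
def ϖ : CyclicByInt n r := ⟨0, 1⟩

@[simp] theorem ζ_e : (ζ n r).e = 1 := rfl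
@[simp] theorem ζ_v : (ζ n r).v = 0 := rfl
@[simp] theorem ϖ_e : (ϖ n r).e = 0 := rfl
@[simp] theorem ϖ_v : (ϖ n r).v = 1 := rfl

theorem ζ_pow (k : ℕ) : ζ n r ^ k = ⟨k, 0⟩ := by
  induction k with
  | zero => ext <;> simp
  | succ k ih => rw [pow_succ, ih]; ext <;> simp

theorem ζ_zpow (k : ℤ) : ζ n r ^ k = ⟨k, 0⟩ := by
  obtain ⟨k, rfl | rfl⟩ := k.eq_nat_or_neg
  · simp [ζ_pow]
  · rw [zpow_neg, zpow_natCast, ζ_pow]; ext <;> simp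

theorem ϖ_zpow (k : ℤ) : ϖ n r ^ k = ⟨0, k⟩ := by
  have : ∀ k : ℕ, ϖ n r ^ k = ⟨0, k⟩ := fun k => by
    induction k with
    | zero => ext <;> simp
    | succ k ih => rw [pow_succ, ih]; ext <;> simp
  obtain ⟨k, rfl | rfl⟩ := k.eq_nat_or_neg
  · simp [this]
  · rw [zpow_neg, zpow_natCast, this]; ext <;> simp

theorem ϖ_mul_ζ {R : ℕ} (hR : (R : ZMod n) = r) : ϖ n r * ζ n r = ζ n r ^ R * ϖ n r := by
  rw [ζ_pow]; ext <;> simp [hR]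

theorem eq_zpow_mul_zpow (g : CyclicByInt n r) (k : ℤ) (hk : (k : ZMod n) = g.e) :
    g = ζ n r ^ k * ϖ n r ^ g.v := by
  rw [ζ_zpow, ϖ_zpow]; ext <;> simp [hk]

/-- The universal property of the presentation `⟨Z, W | Z ^ n = 1, W * Z = Z ^ R * W⟩`. -/
theorem exists_hom {E : Type*} [Group E] {R : ℕ} (hR : (R : ZMod n) = r) {Z W : E}
    (hZ : Z ^ n = 1) (hW : W * Z = Z ^ R * W) :
    ∃ φ : CyclicByInt n r →* E, φ (ζ n r) = Z ∧ φ (ϖ n r) = W := by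
  let F : ZMod n →+ Additive E := ZMod.lift n ⟨zmultiplesHom _ (Additive.ofMul Z), by
    simpa [zmultiplesHom_apply] using congrArg Additive.ofMul hZ⟩
  let f : ZMod n → E := fun x => (F x).toMul
  have f_int (k : ℤ) : f k = Z ^ k := by
    simp only [f, F, ZMod.lift_coe, zmultiplesHom_apply]; rfl
  have f_add (x y : ZMod n) : f (x + y) = f x * f y := by simp only [f, map_add]; rfl
  have conj_one (x : ZMod n) : W * f x = f (r * x) * W := by
    obtain ⟨k, rfl⟩ := ZMod.intCast_surjective x
    have h1 : ((r : ZMod n) * (k : ZMod n)) = ((R * k : ℤ) : ZMod n) := by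
      push_cast; rw [hR]
    rw [h1, f_int, f_int, zpow_mul, zpow_natCast]
    have h2 : W * Z * W⁻¹ = Z ^ R := by rw [hW]; group
    rw [← h2, conj_zpow]; group
  have conj_inv (x : ZMod n) : W⁻¹ * f x = f (↑r⁻¹ * x) * W⁻¹ := by
    have := conj_one (↑r⁻¹ * x)
    rw [Units.mul_inv_cancel_left] at this
    rw [eq_mul_inv_iff_mul_eq, mul_assoc, inv_mul_eq_iff_eq_mul, this]
  have conj (s : ℤ) : ∀ x, W ^ s * f x = f (↑(r ^ s) * x) * W ^ s := by
    induction s using Int.induction_on with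
    | zero => simp
    | succ k ih =>
      intro x
      rw [zpow_add_one, zpow_add_one, mul_assoc, conj_one, ← mul_assoc, ih, Units.val_mul,
        mul_assoc, mul_assoc]
    | pred k ih =>
      intro x
      rw [zpow_sub_one, zpow_sub_one, mul_assoc, conj_inv, ← mul_assoc, ih, Units.val_mul,
        mul_assoc, mul_assoc]
  refine ⟨MonoidHom.mk' (fun g => f g.e * W ^ g.v) fun g h => ?_, ?_, ?_⟩
  · rw [mul_e, mul_v, f_add, zpow_add, mul_assoc, mul_assoc, ← mul_assoc _ (W ^ g.v), ← conj,
      mul_assoc]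
  · simpa using f_int 1
  · simpa using f_int 0

variable {A : Type*} [AddCommGroup A]

/-- The first of the two invariants of a 2-cocycle `c`: the value of `Z ^ n` for a lift `Z` of `ζ`
to the central extension defined by `c`. -/
def torsionInvariant (n : ℕ) (r : (ZMod n)ˣ) (c : CyclicByInt n r → CyclicByInt n r → A) : A :=
  ∑ i ∈ Finset.range n, c (ζ n r ^ i) (ζ n r)

/-- The second of the two invariants of a 2-cocycle `c`: the quotient of `W * Z` by `Z ^ R * W` for
lifts `Z`, `W` of `ζ`, `ϖ` to the central extension defined by `c`. -/
def commutatorInvariant (n : ℕ) (r : (ZMod n)ˣ) (R : ℕ)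
    (c : CyclicByInt n r → CyclicByInt n r → A) : A :=
  c (ϖ n r) (ζ n r) - c (ζ n r ^ R) (ϖ n r) - ∑ i ∈ Finset.range R, c (ζ n r ^ i) (ζ n r) + c 1 1

/-- A cocycle is trivial when its central extension splits, and by the presentation a splitting is a
choice of lifts of `ζ` and `ϖ` satisfying the two relations. Shifting the lift of `ζ` by −z corrects
the defects by nz and z − Rz. Shifting the lift of `ϖ` changes nothing, since it occurs once on each
side of the second relation. -/
theorem isTwoCoboundary_iff {c : CyclicByInt n r → CyclicByInt n r → A} (hc : IsTwoCocycle c)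
    {R : ℕ} (hR : (R : ZMod n) = r) :
    IsTwoCoboundary c ↔
      ∃ z : A, torsionInvariant n r c = n • z ∧ commutatorInvariant n r R c = z - R • z := by
  have hn : ζ n r ^ n = 1 := by rw [ζ_pow]; ext <;> simp
  constructor
  · rintro ⟨b, hb⟩
    have key (k : ℕ) : ∑ i ∈ Finset.range k, c (ζ n r ^ i) (ζ n r) =
        k • b (ζ n r) + b 1 - b (ζ n r ^ k) := by
      induction k with
      | zero => simp
      | succ k ih => rw [Finset.sum_range_succ, ih, hb, succ_nsmul, pow_succ]; abel
    refine ⟨b (ζ n r), ?_, ?_⟩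
    · rw [torsionInvariant, key, hn]; abel
    · rw [commutatorInvariant, key, hb, hb, hb, ϖ_mul_ζ hR, mul_one]; abel
  · rintro ⟨z, hz, hz'⟩
    let Z : CentralExtension hc := ⟨-z, ζ n r⟩
    let W : CentralExtension hc := ⟨0, ϖ n r⟩
    have hZ : Z ^ n = 1 := by
      rw [CentralExtension.pow_eq]
      ext1
      · change _ - _ + torsionInvariant n r c = -c 1 1
        rw [hz, smul_neg]; abel
      · exact hn
    have hW : W * Z = Z ^ R * W := by
      rw [CentralExtension.pow_eq]
      ext1
      · change 0 + -z + c (ϖ n r) (ζ n r) = _ - _ + _ + 0 + c (ζ n r ^ R) (ϖ n r)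
        rw [commutatorInvariant] at hz'
        rw [← sub_eq_zero] at hz' ⊢
        rw [← hz', smul_neg]
        abel
      · exact ϖ_mul_ζ hR
    obtain ⟨φ, h1, h2⟩ := exists_hom hR hZ hW
    refine CentralExtension.isTwoCoboundary_of_section φ fun g => ?_
    obtain ⟨k, hk⟩ := ZMod.intCast_surjective g.e
    change CentralExtension.proj hc (φ g) = g
    conv_lhs => rw [eq_zpow_mul_zpow g k hk]
    rw [map_mul, map_zpow, map_zpow, map_mul, map_zpow, map_zpow, h1, h2]
    exact (eq_zpow_mul_zpow g k hk).symm

section ModTwo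

/-- The parity character of `CyclicByInt n r` for even `n`. -/
def parity (hn : 2 ∣ n) (g : CyclicByInt n r) : ZMod 2 := ZMod.castHom hn (ZMod 2) g.e

theorem parity_mul (hn : 2 ∣ n) (g h : CyclicByInt n r) :
    parity hn (g * h) = parity hn g + parity hn h := by
  have : ZMod.castHom hn (ZMod 2) ↑(r ^ g.v) = 1 := by
    have : ∀ u : (ZMod 2)ˣ, u = 1 := by decide
    exact congrArg Units.val (this (Units.map (ZMod.castHom hn (ZMod 2)).toMonoidHom (r ^ g.v)))
  rw [parity, mul_e, map_add, map_mul, this, one_mul, parity, parity]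

/-- A cocycle detecting the second invariant: the cup product of the two characters. -/
theorem exists_cocycle_commutatorInvariant (hn : 2 ∣ n) (R : ℕ) :
    ∃ c : CyclicByInt n r → CyclicByInt n r → ZMod 2, IsTwoCocycle c ∧
      torsionInvariant n r c = 0 ∧ commutatorInvariant n r R c = 1 := by
  refine ⟨fun g h => g.v * parity hn h, fun g h k => ?_, ?_, ?_⟩
  · simp only [parity_mul, mul_v, Int.cast_add]; ring
  · simp [torsionInvariant, ζ_pow]
  · have : parity hn (ζ n r) = 1 := map_one _
    simp [commutatorInvariant, ζ_pow, this]

/-- A cocycle detecting the first invariant: the carry of the addition in `ZMod n`, viewed in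
`ZMod (2 * n)`. -/
theorem exists_cocycle_torsionInvariant (hn : 1 < n) :
    ∃ c : CyclicByInt n r → CyclicByInt n r → ZMod 2, IsTwoCocycle c ∧
      torsionInvariant n r c = 1 := by
  have : NeZero n := ⟨by omega⟩
  have : NeZero (2 * n) := ⟨by omega⟩
  -- With a unit r' lifting r, the group ℤ/2n ⋊ ℤ is an extension of ℤ/n ⋊ ℤ by ℤ/2; the cocycle
  -- comes from its set-theoretic section `l`.
  obtain ⟨r', hr'⟩ := ZMod.unitsMap_surjective (Dvd.intro_left 2 rfl : n ∣ 2 * n) r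
  let p : ZMod (2 * n) →+* ZMod n := ZMod.castHom (Dvd.intro_left 2 rfl) (ZMod n)
  have hpr (k : ℤ) : p ↑(r' ^ k) = ↑(r ^ k) := by
    rw [← hr', ← map_zpow]; rfl
  have h0 : (2 * n : ZMod (2 * n)) = 0 := by exact_mod_cast ZMod.natCast_self (2 * n)
  let j : ZMod 2 →+ ZMod (2 * n) :=
    ZMod.lift 2 ⟨zmultiplesHom _ (n : ZMod (2 * n)), by simpa using h0⟩
  have hj (k : ℕ) : j k = k * n := by
    have := ZMod.lift_coe 2 ⟨zmultiplesHom _ (n : ZMod (2 * n)), by simpa using h0⟩ k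
    simpa using this
  have hj1 : j 1 = n := by simpa using hj 1
  have j_inj : Function.Injective j := by
    rw [injective_iff_map_eq_zero]
    have h1 : j 1 ≠ 0 := by
      rw [hj1, Ne, ZMod.natCast_eq_zero_iff]
      exact fun h => by have := Nat.le_of_dvd (by omega) h; omega
    intro a
    fin_cases a
    · exact fun _ => rfl
    · exact fun h => absurd h h1
  have j_range (x : ZMod (2 * n)) (hx : p x = 0) : ∃ y, j y = x := by
    obtain ⟨m, rfl⟩ := ZMod.natCast_zmod_surjective x
    rw [map_natCast, ZMod.natCast_eq_zero_iff] at hx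
    obtain ⟨t, rfl⟩ := hx
    exact ⟨t, by rw [hj]; push_cast; ring⟩
  -- Units modulo 2n are odd, so they fix the multiples of n: the extension is central.
  have j_smul (u : (ZMod (2 * n))ˣ) (y : ZMod 2) : ↑u * j y = j y := by
    obtain ⟨k, rfl⟩ := ZMod.natCast_zmod_surjective y
    have hodd : Odd (u : ZMod (2 * n)).val := by
      have := ZMod.val_coe_unit_coprime u
      exact Nat.coprime_two_right.mp (this.coprime_mul_right_right)
    obtain ⟨m, hm⟩ := hodd
    have hu : (u : ZMod (2 * n)) = 2 * m + 1 := by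
      rw [← ZMod.natCast_zmod_val (u : ZMod (2 * n)), hm]; push_cast; rfl
    rw [hj, hu]
    linear_combination (k * m : ZMod (2 * n)) * h0
  let l : CyclicByInt n r → ZMod (2 * n) := fun g => (g.e.val : ZMod (2 * n))
  have hl (g) : p (l g) = g.e := by simp [l]
  have hδ (g h : CyclicByInt n r) : ∃ y, j y = l g + ↑(r' ^ g.v) * l h - l (g * h) := by
    apply j_range
    rw [map_sub, map_add, map_mul, hl, hl, hl, hpr, mul_e, sub_self]
  choose c hc using hδ
  refine ⟨c, fun g h k => j_inj ?_, j_inj ?_⟩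
  · rw [map_add, map_add, ← j_smul (r' ^ g.v) (c h k), hc, hc, hc, hc, mul_v, zpow_add,
      Units.val_mul, mul_assoc g h k]
    ring
  · have key (k : ℕ) : ∑ i ∈ Finset.range k, j (c (ζ n r ^ i) (ζ n r)) =
        k * l (ζ n r) + l 1 - l (ζ n r ^ k) := by
      induction k with
      | zero => simp
      | succ k ih =>
        rw [Finset.sum_range_succ, ih, hc, ← pow_succ, ζ_pow]
        simp; ring
    have h1 : l (ζ n r) = 1 := by
      have : Fact (1 < n) := ⟨hn⟩
      simp only [l, ζ_e, ZMod.val_one, Nat.cast_one]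
    have h2 : ζ n r ^ n = 1 := by rw [ζ_pow]; ext <;> simp
    rw [torsionInvariant, map_sum, key, h1, h2, hj1]
    ring

/-- Every pair of invariants is attained by a 2-cocycle with values in `ZMod 2`. -/
theorem exists_cocycle (hn : 2 ∣ n) (hn0 : n ≠ 0) (R : ℕ) (a b : ZMod 2) :
    ∃ c : CyclicByInt n r → CyclicByInt n r → ZMod 2, IsTwoCocycle c ∧
      torsionInvariant n r c = a ∧ commutatorInvariant n r R c = b := by
  obtain ⟨c, hc, hca⟩ := exists_cocycle_torsionInvariant (r := r)
    (show 1 < n from (Nat.le_of_dvd (Nat.pos_of_ne_zero hn0) hn))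
  obtain ⟨d, hd, hda, hdb⟩ := exists_cocycle_commutatorInvariant (r := r) hn R
  -- The second invariant of `c` is not known; a multiple of `d`, whose first invariant vanishes,
  -- corrects it.
  let t := b - a * commutatorInvariant n r R c
  refine ⟨fun g h => a * c g h + t * d g h, fun g h k => ?_, ?_, ?_⟩
  · linear_combination a * hc g h k + t * hd g h k
  · rw [torsionInvariant] at *
    rw [Finset.sum_add_distrib, ← Finset.mul_sum, ← Finset.mul_sum, hca, hda]
    ring
  · have : commutatorInvariant n r R (fun g h => a * c g h + t * d g h) =
        a * commutatorInvariant n r R c + t * commutatorInvariant n r R d := by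
      simp only [commutatorInvariant, Finset.sum_add_distrib, ← Finset.mul_sum]
      ring
    rw [this, hdb]
    ring

end ModTwo

end CyclicByInt

/-! ### Pro-odd groups: means modulo 2 and homomorphisms of odd exponent -/

open Topology Filter

/-- The open normal subgroups of odd index form a basis of neighbourhoods of the identity. -/
def HasOddIndexBasis (N : Type*) [Group N] [TopologicalSpace N] : Prop :=
  ∀ U ∈ 𝓝 (1 : N), ∃ V : Subgroup N, V.Normal ∧ IsOpen (V : Set N) ∧ Odd V.index ∧ (V : Set N) ⊆ U

section Mean

variable {N : Type*} [Group N] [TopologicalSpace N] [IsTopologicalGroup N] [CompactSpace N]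

/-- The tube lemma; it supplies all the uniformity over compact subgroups used below. -/
theorem eventually_forall_of_open {X Y : Type*} [TopologicalSpace X] [TopologicalSpace Y]
    [CompactSpace Y] {S : Set (X × Y)} (hS : IsOpen S) {x : X} (hx : ∀ y, (x, y) ∈ S) :
    ∀ᶠ x' in 𝓝 x, ∀ y, (x', y) ∈ S := by
  have := isCompact_univ.eventually_forall_of_forall_eventually (x₀ := x) (K := (Set.univ : Set Y))
    (P := fun x y => (x, y) ∈ S) fun y _ => hS.mem_nhds (hx y)
  simpa using this

/-- A translation invariant mean with values in `ZMod 2` on a compact group with arbitrarily small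
open normal subgroups of odd index. -/
theorem HasOddIndexBasis.exists_mean (hN : HasOddIndexBasis N) :
    ∃ m : (N → ZMod 2) →+ ZMod 2, (∀ a, m (fun _ => a) = a) ∧
      ∀ f : N → ZMod 2, Continuous f → ∀ x, m (fun y => f (x * y)) = m f := by
  classical
  let I := {V : Subgroup N // V.Normal ∧ Odd V.index}
  -- Along this filter the subgroups shrink to the identity. An ultrafilter refining it gives every
  -- ℤ/2-valued family a limit, so the mean exists even for discontinuous functions.
  let F : Filter I := comap (fun V : I => (V.1 : Set N)) (𝓝 1).smallSets
  have : F.NeBot := by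
    refine comap_neBot fun t ht => ?_
    obtain ⟨U, hU, hUt⟩ := eventually_smallSets.1 ht
    obtain ⟨V, h1, -, h2, h3⟩ := hN U hU
    exact ⟨⟨V, h1, h2⟩, hUt _ h3⟩
  let 𝓤 : Ultrafilter I := Ultrafilter.of F
  have hfin (V : I) : Finite (N ⧸ V.1) := by
    have : V.1.FiniteIndex := ⟨V.2.2.pos.ne'⟩
    infer_instance
  let s (V : I) (f : N → ZMod 2) : ZMod 2 :=
    letI := Fintype.ofFinite (N ⧸ V.1)
    ∑ q : N ⧸ V.1, f q.out
  have hlim (f) : ∃ t, ∀ᶠ V in 𝓤, s V f = t := by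
    have h01 : ∀ a : ZMod 2, a = 0 ∨ a = 1 := by decide
    have : ∀ᶠ V in 𝓤, s V f = 0 ∨ s V f = 1 := Eventually.of_forall fun V => h01 _
    rcases Ultrafilter.eventually_or.1 this with h | h
    exacts [⟨_, h⟩, ⟨_, h⟩]
  choose m hm using hlim
  refine ⟨AddMonoidHom.mk' m fun f g => ?_, fun a => ?_, fun f hf x => ?_⟩
  · obtain ⟨V, h1, h2, h3⟩ := ((hm (f + g)).and ((hm f).and (hm g))).exists
    rw [← h1, ← h2, ← h3]
    exact Finset.sum_add_distrib
  · obtain ⟨V, hV⟩ := (hm fun _ => a).exists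
    change m _ = a
    rw [← hV]
    let := Fintype.ofFinite (N ⧸ V.1)
    change ∑ q : N ⧸ V.1, a = a
    rw [Finset.sum_const, Finset.card_univ, ← Nat.card_eq_fintype_card, ← Subgroup.index,
      nsmul_eq_mul, ZMod.natCast_eq_one_iff_odd.2 V.2.2, one_mul]
  · have hS : IsOpen {p : N × N | f (p.2 * p.1) = f p.2} :=
      (isOpen_discrete {p : ZMod 2 × ZMod 2 | p.1 = p.2}).preimage
        (f := fun p : N × N => (f (p.2 * p.1), f p.2)) (by fun_prop)
    have h1 := eventually_forall_of_open hS (x := 1) (by simp)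
    have h2 : ∀ᶠ V in F, ∀ u ∈ V.1, ∀ y, f (y * u) = f y :=
      Eventually.comap (p := fun t : Set N => ∀ u ∈ t, ∀ y, f (y * u) = f y)
        (eventually_smallSets.2 ⟨_, h1, fun t ht u hu => ht hu⟩) _
    obtain ⟨V, h3, h4, h5⟩ :=
      ((hm (fun y => f (x * y))).and ((hm f).and (Ultrafilter.of_le F h2))).exists
    change m _ = m f
    rw [← h3, ← h4]
    let := Fintype.ofFinite (N ⧸ V.1)
    change ∑ q : N ⧸ V.1, f (x * q.out) = ∑ q : N ⧸ V.1, f q.out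
    -- Left translation permutes the cosets, and `f` is constant on cosets of `V`, so the choice of
    -- representatives is harmless.
    refine Fintype.sum_equiv (MulAction.toPerm x) _ _ fun q => ?_
    have hq : (x • q : N ⧸ V.1) = ((x * q.out : N) : N ⧸ V.1) := by
      conv_lhs => rw [← q.out_eq']
      rfl
    rw [MulAction.toPerm_apply, hq]
    obtain ⟨u, hu⟩ := QuotientGroup.mk_out_eq_mul V.1 (x * q.out)
    rw [hu, h5 _ u.2]

end Mean

section NoSmallSubgroups

variable {N : Type*} [Group N] [TopologicalSpace N]

/-- If the target has no small subgroups, a continuous homomorphism from a group with arbitrarily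
small open normal subgroups of odd index is killed by an odd number. -/
theorem HasOddIndexBasis.exists_odd_smul_eq_zero (hN : HasOddIndexBasis N) {A : Type*}
    [AddCommGroup A] [TopologicalSpace A]
    (hA : ∃ W ∈ 𝓝 (0 : A), ∀ H : AddSubgroup A, (H : Set A) ⊆ W → H = ⊥)
    (χ : N →* Multiplicative A) (hχ : Continuous fun x => (χ x).toAdd) :
    ∃ M : ℕ, Odd M ∧ ∀ x, M • (χ x).toAdd = 0 := by
  obtain ⟨W, hW, hWA⟩ := hA
  have : W ∈ 𝓝 ((χ 1).toAdd) := by simpa using hW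
  obtain ⟨V, hV, -, hodd, hVW⟩ := hN _ (hχ.continuousAt this)
  refine ⟨V.index, hodd, fun x => ?_⟩
  have h1 : χ (x ^ V.index) ∈ V.map χ := ⟨_, V.pow_index_mem x, rfl⟩
  have h2 := hWA (Subgroup.toAddSubgroup' (V.map χ)) (by
    rintro _ ⟨v, hv, rfl⟩
    exact hVW hv)
  have h3 : (χ (x ^ V.index)).toAdd ∈ Subgroup.toAddSubgroup' (V.map χ) := h1
  rw [h2, AddSubgroup.mem_bot, map_pow] at h3
  exact h3

end NoSmallSubgroups

theorem zmodTwo_noSmallSubgroups :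
    ∃ W ∈ 𝓝 (0 : ZMod 2), ∀ H : AddSubgroup (ZMod 2), (H : Set (ZMod 2)) ⊆ W → H = ⊥ :=
  ⟨{0}, by simp, fun H hH => by rw [eq_bot_iff]; exact fun x hx => hH hx⟩

/-- Within distance 1/2 of 1, squaring multiplies the distance to 1 by at least 3/2, because z² − 1
= (2 + (z − 1))(z − 1). A nontrivial element would therefore have a power outside the ball. -/
theorem complexUnits_noSmallSubgroups :
    ∃ W ∈ 𝓝 (0 : Additive ℂˣ), ∀ H : AddSubgroup (Additive ℂˣ),
      (H : Set (Additive ℂˣ)) ⊆ W → H = ⊥ := by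
  have hcont : Continuous fun x : Additive ℂˣ => ‖(x.toMul : ℂ) - 1‖ :=
    ((Units.continuous_val.comp continuous_toMul).sub continuous_const).norm
  refine ⟨{x | ‖(x.toMul : ℂ) - 1‖ < 1 / 2}, ?_, fun H hH => ?_⟩
  · exact (isOpen_lt hcont continuous_const).mem_nhds (by simp)
  · rw [eq_bot_iff]
    intro x hx
    have step (z : Additive ℂˣ) (hz : z ∈ H) :
        3 / 2 * ‖(z.toMul : ℂ) - 1‖ ≤ ‖((z + z).toMul : ℂ) - 1‖ := by
      have h1 := hH hz
      simp only [Set.mem_ofPred_eq] at h1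
      have h2 : ((z + z).toMul : ℂ) - 1 = (2 + ((z.toMul : ℂ) - 1)) * ((z.toMul : ℂ) - 1) := by
        rw [toMul_add, Units.val_mul]; ring
      have h3 : (3 / 2 : ℝ) ≤ ‖2 + ((z.toMul : ℂ) - 1)‖ := by
        have := norm_sub_le (2 + ((z.toMul : ℂ) - 1)) ((z.toMul : ℂ) - 1)
        rw [add_sub_cancel_right, Complex.norm_ofNat] at this
        linarith
      rw [h2, norm_mul]
      gcongr
    have iter (k : ℕ) : (3 / 2 : ℝ) ^ k * ‖(x.toMul : ℂ) - 1‖ ≤ 1 / 2 := by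
      have : ∀ k : ℕ, ∃ z ∈ H, (3 / 2 : ℝ) ^ k * ‖(x.toMul : ℂ) - 1‖ ≤ ‖(z.toMul : ℂ) - 1‖ := by
        intro k
        induction k with
        | zero => exact ⟨x, hx, by simp⟩
        | succ k ih =>
          obtain ⟨z, hz, h⟩ := ih
          refine ⟨z + z, H.add_mem hz hz, le_trans ?_ (step z hz)⟩
          rw [pow_succ]
          linarith
      obtain ⟨z, hz, h⟩ := this k
      exact h.trans (hH hz).le
    by_contra hne
    have hpos : 0 < ‖(x.toMul : ℂ) - 1‖ := by
      rw [norm_pos_iff, sub_ne_zero]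
      intro h
      exact hne (Units.ext h)
    obtain ⟨k, hk⟩ :=
      pow_unbounded_of_one_lt (1 / ‖(x.toMul : ℂ) - 1‖) (by norm_num : (1 : ℝ) < 3 / 2)
    rw [div_lt_iff₀ hpos] at hk
    linarith [iter k]

/-! ### Inflation from the quotient by a pro-odd kernel -/

section Inflation

variable {G Q : Type*} [Group G] [TopologicalSpace G] [Group Q] {π : G →* Q}

/-- If the inflation of a cocycle killed by two is the coboundary of a continuous cochain, then
the cocycle itself is a coboundary. -/
theorem isTwoCoboundary_of_inflation (hπ : Function.Surjective π) (hN : HasOddIndexBasis π.ker)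
    {A : Type*} [AddCommGroup A] [TopologicalSpace A] [IsTopologicalAddGroup A]
    (hA : ∃ W ∈ 𝓝 (0 : A), ∀ H : AddSubgroup A, (H : Set A) ⊆ W → H = ⊥)
    {c₀ : Q → Q → A} (hc₀ : IsTwoCocycle c₀) (h2 : ∀ p q, 2 • c₀ p q = 0) (b : C(G, A))
    (hb : ∀ g h, c₀ (π g) (π h) = b g + b h - b (g * h)) : IsTwoCoboundary c₀ := by
  have hb1 : c₀ 1 1 = b 1 := by simpa using hb 1 1
  have hker (g : G) (x : π.ker) : b (g * x) = b g + (b x - b 1) := by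
    have h1 := hb g x
    rw [show π (x : G) = 1 from x.2, hc₀.one_right, hb1] at h1
    rw [h1]
    abel
  let χ : π.ker →* Multiplicative A := MonoidHom.mk' (fun x => Multiplicative.ofAdd (b x - b 1))
    fun x y => by
      rw [← ofAdd_add]
      congr 1
      rw [Subgroup.coe_mul, hker]
      abel
  obtain ⟨M, ⟨t, ht⟩, hM⟩ := hN.exists_odd_smul_eq_zero hA χ (by
    change Continuous fun x : π.ker => b x - b 1
    fun_prop)
  obtain ⟨s, hs⟩ := hπ.hasRightInverse
  have key (g : G) : M • b (s (π g)) = M • b g := by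
    let x : π.ker := ⟨g⁻¹ * s (π g), by simp [MonoidHom.mem_ker, hs (π g)]⟩
    have h1 : s (π g) = g * x := by simp [x]
    have h2 : M • (b x - b 1) = 0 := hM x
    rw [h1, hker, nsmul_add, h2, add_zero]
  refine ⟨fun p => M • b (s p), fun p q => ?_⟩
  obtain ⟨g, rfl⟩ := hπ p
  obtain ⟨h, rfl⟩ := hπ q
  simp only [← map_mul, key]
  -- As `M` is odd and the cocycle is killed by 2, multiplying it by `M` does not change it.
  rw [← nsmul_add, ← nsmul_sub, ← hb, ht, add_nsmul, one_nsmul,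
    mul_comm, mul_nsmul', h2, nsmul_zero, zero_add]

variable [IsTopologicalGroup G]

theorem continuous_comp_of_isOpen_ker (hopen : IsOpen (π.ker : Set G)) {X : Type*}
    [TopologicalSpace X] (f : Q → X) : Continuous fun g => f (π g) := by
  refine (IsLocallyConstant.iff_eventually_eq _).2 (fun g => ?_) |>.continuous
  have : ∀ᶠ h in 𝓝 g, g⁻¹ * h ∈ π.ker :=
    (continuous_const_mul g⁻¹).continuousAt (hopen.mem_nhds (by simp))
  filter_upwards [this] with h hh
  rw [MonoidHom.mem_ker, map_mul, map_inv, inv_mul_eq_one] at hh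
  rw [hh]

theorem continuous_comp₂_of_isOpen_ker (hopen : IsOpen (π.ker : Set G)) {X : Type*}
    [TopologicalSpace X] (f : Q → Q → X) : Continuous fun p : G × G => f (π p.1) (π p.2) := by
  have : IsOpen ((π.prodMap π).ker : Set (G × G)) := by
    convert hopen.prod hopen
    ext p
    simp [MonoidHom.mem_ker, Prod.ext_iff]
  exact continuous_comp_of_isOpen_ker this fun p : Q × Q => f p.1 p.2

/-- Every continuous cocycle with values in `ZMod 2` is cohomologous to one inflated from the
quotient by a compact open normal subgroup of pro-odd order. -/
theorem exists_eq_inflation_add_coboundary (hπ : Function.Surjective π)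
    [CompactSpace π.ker] (hN : HasOddIndexBasis π.ker)
    {c : C(G × G, ZMod 2)} (hc : c ∈ contZ2 G (ZMod 2)) :
    ∃ (c₀ : Q → Q → ZMod 2) (b : C(G, ZMod 2)), IsTwoCocycle c₀ ∧
      ∀ g h, c (g, h) = c₀ (π g) (π h) + (b g + b h - b (g * h)) := by
  obtain ⟨m, m_const, m_inv⟩ := hN.exists_mean
  have hcont (g h : G) : Continuous fun x : π.ker => c (g, h * x) := by fun_prop
  -- Averaging the cocycle identity over its last variable in the kernel makes the corrected cocycle
  -- `d` right invariant in its second argument.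
  let b : C(G, ZMod 2) := ⟨fun g => m fun x => c (g, x), by
    refine (IsLocallyConstant.iff_eventually_eq _).2 (fun g => ?_) |>.continuous
    have hS : IsOpen {p : G × π.ker | c (p.1, p.2) = c (g, p.2)} :=
      (isOpen_discrete {p : ZMod 2 × ZMod 2 | p.1 = p.2}).preimage
        (f := fun p : G × π.ker => (c (p.1, p.2), c (g, p.2))) (by fun_prop)
    filter_upwards [eventually_forall_of_open hS (x := g) (by simp)] with h hh
    exact congrArg m (funext hh)⟩
  let d (g h : G) : ZMod 2 := c (g, h) - (b g + b h - b (g * h))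
  have hd (g h k : G) : d h k + d g (h * k) = d (g * h) k + d g h := by
    have := hc g h k
    simp only [d, mul_assoc]
    linear_combination this
  have hd_eq (g h : G) : d g h = m (fun x => c (g, h * x)) - b g := by
    have h1 : b h + m (fun x => c (g, h * x)) = b (g * h) + c (g, h) := by
      rw [← m_const (c (g, h))]
      change m _ + m _ = m _ + m _
      rw [← map_add, ← map_add]
      exact congrArg m (funext fun x => hc g h x)
    simp only [d]
    linear_combination -h1
  have hd_right (g h : G) (x : π.ker) : d g (h * x) = d g h := by
    rw [hd_eq, hd_eq, ← m_inv _ (hcont g h) x]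
    simp [mul_assoc]
  have hd_ker (g : G) (x : π.ker) : d g x = 0 := by
    have h1 := hd_right g 1 x
    rw [one_mul] at h1
    rw [h1, hd_eq]
    simp only [one_mul]
    exact sub_self _
  have hd_mul (g h : G) (x : π.ker) : d (g * x) h = d x h + d g h := by
    have h1 := hd g x h
    rw [hd_ker, add_zero] at h1
    rw [← h1]
    have h2 : (x : G) * h = h * (⟨h⁻¹ * x * h, by
      simpa using (MonoidHom.normal_ker π).conj_mem x x.2 h⁻¹⟩ : π.ker) := by simp [mul_assoc]
    conv_rhs => rw [← hd_right g h, ← h2]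
  have hd_cont (h : G) : Continuous fun x : π.ker => d x h := by
    simp only [d]
    fun_prop
  -- On the kernel `d` is additive in its first argument, so translating by `x` adds `d x h` to the
  -- mean; invariance of the mean forces this to vanish.
  have hd_left_ker (h : G) (x : π.ker) : d x h = 0 := by
    have h1 := m_inv _ (hd_cont h) x
    have h2 : (fun y : π.ker => d (x * y : π.ker) h) =
        (fun y : π.ker => d y h) + fun _ => d x h := by
      funext y
      exact hd_mul x h y
    rw [h2, map_add, m_const] at h1
    simpa using h1
  have hd_left (g h : G) (x : π.ker) : d (g * x) h = d g h := by
    rw [hd_mul, hd_left_ker, zero_add]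
  obtain ⟨s, hs⟩ := hπ.hasRightInverse
  have hs' (g : G) : ∃ x : π.ker, s (π g) = g * x :=
    ⟨⟨g⁻¹ * s (π g), by simp [MonoidHom.mem_ker, hs (π g)]⟩, by simp⟩
  have key (g h : G) : d (s (π g)) (s (π h)) = d g h := by
    obtain ⟨x, hx⟩ := hs' g
    obtain ⟨y, hy⟩ := hs' h
    rw [hx, hy, hd_left, hd_right]
  refine ⟨fun p q => d (s p) (s q), b, fun p q t => ?_, fun g h => ?_⟩
  · obtain ⟨g, rfl⟩ := hπ p
    obtain ⟨h, rfl⟩ := hπ q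
    obtain ⟨k, rfl⟩ := hπ t
    simp only [← map_mul, key]
    exact hd g h k
  · simp only [key, d]
    ring

end Inflation

/-! ### Continuous square roots -/

section SquareRoot

/-- A continuous square root exists for every continuous map into `ℂˣ` on a topological group with
a compact open subgroup having small open subgroups. -/
theorem exists_continuous_half {G : Type*} [Group G] [TopologicalSpace G] [IsTopologicalGroup G]
    {N : Subgroup G} (hopen : IsOpen (N : Set G)) [CompactSpace N] (hN : HasOddIndexBasis N)
    (β : C(G, Additive ℂˣ)) : ∃ γ : C(G, Additive ℂˣ), ∀ g, β g = 2 • γ g := by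
  have hslit : IsOpen {u : Additive ℂˣ | (u.toMul : ℂ) ∈ Complex.slitPlane} :=
    Complex.isOpen_slitPlane.preimage (Units.continuous_val.comp continuous_toMul)
  have hV (g : G) : ∃ V : Subgroup N, IsOpen (V : Set N) ∧
      ∀ x : N, ∀ u ∈ V, ((β (g * (x * u)) - β (g * x)).toMul : ℂ) ∈ Complex.slitPlane := by
    have hS : IsOpen {p : N × N |
        ((β (g * (p.2 * p.1)) - β (g * p.2)).toMul : ℂ) ∈ Complex.slitPlane} :=
      hslit.preimage (f := fun p : N × N => β (g * (p.2 * p.1)) - β (g * p.2)) (by fun_prop)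
    obtain ⟨V, -, h1, -, h2⟩ := hN _ (eventually_forall_of_open hS (x := 1) (by simp))
    exact ⟨V, h1, fun x u hu => h2 hu x⟩
  choose V hVo hV using hV
  let base (g : G) : G := (g : G ⧸ N).out
  have hbase (g : G) : (base g)⁻¹ * g ∈ N :=
    QuotientGroup.eq.1 (QuotientGroup.out_eq' (g : G ⧸ N))
  let rep (g : G) : N := ((⟨(base g)⁻¹ * g, hbase g⟩ : N) : N ⧸ V (base g)).out
  -- A locally constant choice of nearby point: `β g` divided by `β (ρ g)` avoids the branch cut, so
  -- the principal logarithm gives its root, while any root of `β (ρ g)` will do.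
  let ρ (g : G) : G := base g * rep g
  have hρ_slit (g : G) : ((β g - β (ρ g)).toMul : ℂ) ∈ Complex.slitPlane := by
    have h1 : (rep g)⁻¹ * ⟨(base g)⁻¹ * g, hbase g⟩ ∈ V (base g) :=
      QuotientGroup.eq.1 (QuotientGroup.out_eq' _)
    have h2 := hV (base g) (rep g) _ h1
    simpa [ρ] using h2
  have hρ_const (g : G) : ∀ᶠ h in 𝓝 g, ρ h = ρ g := by
    have h1 : IsOpen (Subtype.val '' (V (base g) : Set N)) :=
      hopen.isOpenEmbedding_subtypeVal.isOpenMap _ (hVo (base g))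
    have h2 : ∀ᶠ h in 𝓝 g, g⁻¹ * h ∈ Subtype.val '' (V (base g) : Set N) :=
      (continuous_const_mul g⁻¹).continuousAt (h1.mem_nhds ⟨1, one_mem _, by simp⟩)
    filter_upwards [h2] with h hh
    obtain ⟨u, hu, huh⟩ := hh
    have h3 : base h = base g := by
      have : (h : G ⧸ N) = g := (QuotientGroup.eq.2 (huh ▸ u.2)).symm
      simp only [base, this]
    -- The type of the coset depends on the base point, hence the variable `t`.
    have h4 : ∀ t (ht : t⁻¹ * h ∈ N), t = base g →
        ((⟨t⁻¹ * h, ht⟩ : N) : N ⧸ V t).out = rep g := by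
      rintro _ ht rfl
      have : ((⟨(base g)⁻¹ * h, ht⟩ : N) : N ⧸ V (base g)) =
          ((⟨(base g)⁻¹ * g, hbase g⟩ : N) : N ⧸ V (base g)) := by
        refine (QuotientGroup.eq.2 ?_).symm
        rw [SetLike.mem_coe] at hu
        convert hu using 1
        apply Subtype.ext
        simp [huh, mul_assoc]
      rw [this]
    have h5 : rep h = rep g := h4 _ (hbase h) h3
    simp only [ρ, h3, h5]
  have hsqrt (u : ℂˣ) : ∃ w : ℂˣ, u = w ^ 2 := by
    obtain ⟨w, hw⟩ := IsAlgClosed.exists_pow_nat_eq (u : ℂ) two_pos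
    have : w ≠ 0 := by rintro rfl; exact u.ne_zero (by simpa using hw.symm)
    exact ⟨Units.mk0 w this, Units.ext hw.symm⟩
  choose σ hσ using hsqrt
  let τ (u : ℂˣ) : ℂˣ := Units.mk0 (Complex.exp (Complex.log u / 2)) (Complex.exp_ne_zero _)
  have hτ (u : ℂˣ) : τ u ^ 2 = u := by
    ext
    simp only [τ, Units.val_pow_eq_pow_val, Units.val_mk0, ← Complex.exp_nat_mul]
    rw [Nat.cast_ofNat, mul_div_cancel₀ _ two_ne_zero, Complex.exp_log u.ne_zero]
  have hcont : Continuous fun g => σ (β (ρ g)).toMul * τ (β g - β (ρ g)).toMul := by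
    refine continuous_iff_continuousAt.2 fun g => ?_
    have h1 : ContinuousAt (fun h => σ (β (ρ g)).toMul * τ (β h - β (ρ g)).toMul) g := by
      refine continuousAt_const.mul ?_
      rw [Units.isEmbedding_val₀.continuousAt_iff]
      change ContinuousAt (fun h => Complex.exp (Complex.log ((β h - β (ρ g)).toMul : ℂ) / 2)) g
      refine Complex.continuous_exp.continuousAt.comp (ContinuousAt.div_const ?_ 2)
      refine (continuousAt_clog (hρ_slit g)).comp (f := fun h => ((β h - β (ρ g)).toMul : ℂ)) ?_
      refine (Units.continuous_val.comp (continuous_toMul.comp ?_)).continuousAt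
      fun_prop
    refine h1.congr ?_
    filter_upwards [hρ_const g] with h hh
    rw [hh]
  refine ⟨⟨fun g => Additive.ofMul (σ (β (ρ g)).toMul * τ (β g - β (ρ g)).toMul),
    continuous_ofMul.comp hcont⟩, fun g => ?_⟩
  apply Additive.toMul.injective
  change (β g).toMul = (σ (β (ρ g)).toMul * τ (β g - β (ρ g)).toMul) ^ 2
  rw [mul_pow, ← hσ, hτ, ← toMul_add]
  congr 1
  abel

end SquareRoot

/-! ### Signs in ℂˣ and divisibility -/

section SignCharacter

/-- The sign character of `ZMod 2`. -/
noncomputable def signChar : ZMod 2 →+ Additive ℂˣ :=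
  ZMod.lift 2 ⟨zmultiplesHom _ (Additive.ofMul (-1)), by
    apply Additive.toMul.injective
    simp [zmultiplesHom_apply]⟩

theorem signChar_one : signChar 1 = Additive.ofMul (-1) := by
  have := ZMod.lift_coe 2 ⟨zmultiplesHom _ (Additive.ofMul (-1 : ℂˣ)), by
    apply Additive.toMul.injective
    simp [zmultiplesHom_apply]⟩ 1
  rw [signChar]
  simpa using! this

theorem signChar_injective : Function.Injective signChar := by
  rw [injective_iff_map_eq_zero]
  intro a
  fin_cases a
  · exact fun _ => rfl
  · intro h
    have h1 : (-1 : ℂˣ) = 1 := Additive.ofMul.injective (signChar_one.symm.trans h)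
    have h2 : (-1 : ℂ) = 1 := by simpa using congrArg Units.val h1
    norm_num at h2

theorem two_nsmul_signChar (a : ZMod 2) : 2 • signChar a = 0 := by
  rw [← map_nsmul, nsmul_eq_mul, show ((2 : ℕ) : ZMod 2) = 0 from rfl, zero_mul, map_zero]

theorem exists_signChar_eq {u : Additive ℂˣ} (hu : 2 • u = 0) : ∃ a, signChar a = u := by
  have h1 : (u.toMul : ℂ) ^ 2 = 1 := by
    have : u.toMul ^ 2 = 1 := congrArg Additive.toMul hu
    simpa using congrArg Units.val this
  have hu' (h : (u.toMul : ℂ) = -1) : -1 = u.toMul := Units.ext (by simpa using h.symm)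
  rcases sq_eq_one_iff.1 h1 with h | h
  · exact ⟨0, by rw [map_zero]; exact (Units.ext h).symm⟩
  · exact ⟨1, by rw [signChar_one]; exact congrArg Additive.ofMul (hu' h)⟩

theorem exists_nsmul_eq (u : Additive ℂˣ) {d : ℕ} (hd : 0 < d) : ∃ z, d • z = u := by
  obtain ⟨w, hw⟩ := IsAlgClosed.exists_pow_nat_eq (u.toMul : ℂ) hd
  have hw0 : w ≠ 0 := by
    rintro rfl
    rw [zero_pow hd.ne'] at hw
    exact u.toMul.ne_zero hw.symm
  have h : Units.mk0 w hw0 ^ d = u.toMul := Units.ext (by simpa using hw)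
  exact ⟨Additive.ofMul (Units.mk0 w hw0), congrArg Additive.ofMul h⟩

theorem ne_zero_or_ne_zero_of_coprime {a b : ℕ} (h : Nat.Coprime a b) :
    (a : ZMod 2) ≠ 0 ∨ (b : ZMod 2) ≠ 0 := by
  by_contra! hab
  rw [ZMod.natCast_eq_zero_iff, ZMod.natCast_eq_zero_iff] at hab
  exact absurd (Nat.dvd_gcd hab.1 hab.2) (by rw [h]; decide)

/-- Which pairs of signs are of the form `(z ^ n, z ^ (1 - R))`. -/
theorem exists_signChar_eq_nsmul_iff {d n' r' : ℕ} (hd : 0 < d) (hcop : Nat.Coprime n' r')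
    (a b : ZMod 2) :
    (∃ z, signChar a = (d * n') • z ∧ signChar b = z - (1 + d * r') • z) ↔
      a * r' + b * n' = 0 := by
  have hb (z : Additive ℂˣ) : z - (1 + d * r') • z = -(r' • d • z) := by
    rw [add_nsmul, one_nsmul, mul_comm, mul_nsmul']; abel
  have ha (z : Additive ℂˣ) : (d * n') • z = n' • d • z := by rw [mul_comm, mul_nsmul']
  have hsc (k : ℕ) (t : ZMod 2) : k • signChar t = signChar (k * t) := by
    rw [← map_nsmul, nsmul_eq_mul]
  constructor
  · rintro ⟨z, h1, h2⟩
    rw [ha] at h1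
    rw [hb] at h2
    set u := d • z
    -- Both n' and r' kill `2 • u`, so Bézout makes `u` a sign.
    have hu : 2 • u = 0 := by
      have e1 : n' • 2 • u = 0 := by rw [nsmul_left_comm, ← h1, two_nsmul_signChar]
      have e2 : r' • 2 • u = 0 := by
        have := two_nsmul_signChar b
        rw [h2, neg_nsmul, neg_eq_zero, nsmul_left_comm] at this
        exact this
      have e3 : Nat.gcd n' r' = 1 := hcop
      have := Nat.gcd_eq_gcd_ab n' r'
      rw [e3] at this
      rw [← one_zsmul (2 • u), ← Nat.cast_one, this, add_zsmul,
        mul_comm, mul_zsmul, mul_comm (r' : ℤ), mul_zsmul,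
        natCast_zsmul, natCast_zsmul, e1, e2, zsmul_zero, zsmul_zero, zero_add]
    obtain ⟨t, ht⟩ := exists_signChar_eq hu
    rw [← ht, hsc] at h1
    rw [← ht, hsc, ← map_neg] at h2
    rw [signChar_injective h1, signChar_injective h2]
    ring
  · intro h
    -- In 𝔽₂² the kernel of a nonzero functional is a line, here spanned by (N, R).
    have key : ∀ a b N R : ZMod 2, (N ≠ 0 ∨ R ≠ 0) → a * R + b * N = 0 →
      ∃ t, a = N * t ∧ b = -(R * t) := by decide
    obtain ⟨t, rfl, rfl⟩ := key a b n' r' (ne_zero_or_ne_zero_of_coprime hcop) h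
    obtain ⟨z, hz⟩ := exists_nsmul_eq (signChar t) hd
    refine ⟨z, ?_, ?_⟩
    · rw [ha, hz, hsc]
    · rw [hb, hz, hsc, map_neg]

end SignCharacter

/-! ### Cohomology of an extension of ℤ/n ⋊ ℤ by a pro-odd group -/

section Main

variable (Q A : Type*) [Group Q] [AddCommGroup A]

/-- The group of 2-cocycles of a group with trivial action on the coefficients. -/
def twoCocycles : AddSubgroup (Q → Q → A) where
  carrier := {c | IsTwoCocycle c}
  zero_mem' g h k := by simp
  add_mem' {a b} ha hb g h k := by
    have := congr($(ha g h k) + $(hb g h k))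
    simp only [Pi.add_apply]
    abel_nf at this ⊢
    exact this
  neg_mem' {a} ha g h k := by
    have := congr(-$(ha g h k))
    simp only [Pi.neg_apply]
    abel_nf at this ⊢
    exact this

variable {Q A}

/-- Inflation of cocycles along a homomorphism with open kernel. -/
def inflation {G : Type*} [Group G] [TopologicalSpace G] [IsTopologicalGroup G]
    [TopologicalSpace A] [IsTopologicalAddGroup A] {π : G →* Q} (hopen : IsOpen (π.ker : Set G)) :
    twoCocycles Q A →+ contZ2 G A where
  toFun c := ⟨⟨fun p => c.1 (π p.1) (π p.2), continuous_comp₂_of_isOpen_ker hopen c.1⟩,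
    fun g h k => by simpa using c.2 (π g) (π h) (π k)⟩
  map_zero' := rfl
  map_add' _ _ := rfl

/-- Both targets are the same quotient of `Z`. With `Z` the cocycles of the discrete quotient,
cohomology is compared with the invariants without constructing a map between them. -/
theorem nonempty_addEquiv_of_same_kernel {Z B C : Type*} [AddGroup Z] [AddGroup B] [AddGroup C]
    (f : Z →+ B) (g : Z →+ C) (hf : Function.Surjective f) (hg : Function.Surjective g)
    (h : ∀ z, f z = 0 ↔ g z = 0) : Nonempty (B ≃+ C) :=
  ⟨(QuotientAddGroup.quotientKerEquivOfSurjective f hf).symm.trans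
    ((QuotientAddGroup.quotientAddEquivOfEq (AddSubgroup.ext h)).trans
      (QuotientAddGroup.quotientKerEquivOfSurjective g hg))⟩

namespace CyclicByInt

variable {n : ℕ} {r : (ZMod n)ˣ}

/-- The two invariants of a cocycle as a homomorphism. -/
def invariants (n : ℕ) (r : (ZMod n)ˣ) (R : ℕ) (A : Type*) [AddCommGroup A] :
    twoCocycles (CyclicByInt n r) A →+ A × A :=
  AddMonoidHom.mk' (fun c => (torsionInvariant n r c.1, commutatorInvariant n r R c.1))
    fun c d => by
      ext
      · simp only [torsionInvariant, AddSubgroup.coe_add, Pi.add_apply, Prod.fst_add,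
          Finset.sum_add_distrib]
      · simp only [commutatorInvariant, AddSubgroup.coe_add, Pi.add_apply, Prod.snd_add,
          Finset.sum_add_distrib]
        abel

theorem torsionInvariant_comp {A B : Type*} [AddCommGroup A] [AddCommGroup B] (f : A →+ B)
    (c : CyclicByInt n r → CyclicByInt n r → A) :
    torsionInvariant n r (fun g h => f (c g h)) = f (torsionInvariant n r c) :=
  (map_sum f _ _).symm

theorem commutatorInvariant_comp {A B : Type*} [AddCommGroup A] [AddCommGroup B] (f : A →+ B)
    (R : ℕ) (c : CyclicByInt n r → CyclicByInt n r → A) :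
    commutatorInvariant n r R (fun g h => f (c g h)) = f (commutatorInvariant n r R c) := by
  simp only [commutatorInvariant, map_add, map_sub, map_sum]

end CyclicByInt

/-- Postcomposition of cocycles with a homomorphism of coefficients. -/
def twoCocyclesMap {B : Type*} [AddCommGroup B] (f : A →+ B) :
    twoCocycles Q A →+ twoCocycles Q B where
  toFun c := ⟨fun g h => f (c.1 g h), fun g h k => by simpa using congrArg f (c.2 g h k)⟩
  map_zero' := Subtype.ext (funext fun _ => funext fun _ => map_zero f)
  map_add' _ _ := Subtype.ext (funext fun _ => funext fun _ => map_add f _ _)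

end Main

section Computation

variable {G : Type v} [Group G] [TopologicalSpace G] [IsTopologicalGroup G]
  {n : ℕ} {r : (ZMod n)ˣ} {π : G →* CyclicByInt n r}

open CyclicByInt

/-- Second cohomology with coefficients `ZMod 2` of an extension of `CyclicByInt n r` by a compact
open subgroup of pro-odd order. -/
theorem nonempty_contH2_zmodTwo_addEquiv (hπ : Function.Surjective π)
    (hopen : IsOpen (π.ker : Set G)) [CompactSpace π.ker] (hN : HasOddIndexBasis π.ker)
    (hn : 2 ∣ n) (hn0 : n ≠ 0) : Nonempty (contH2 G (ZMod 2) ≃+ ZMod 2 × ZMod 2) := by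
  have : LocallyCompactSpace G := (isCompact_iff_compactSpace.2 ‹CompactSpace π.ker›)
    |>.locallyCompactSpace_of_mem_nhds_of_group (hopen.mem_nhds (one_mem π.ker))
  have : NeZero n := ⟨hn0⟩
  obtain ⟨p, hp, hp'⟩ := exists_contZ2_to_contH2 G (ZMod 2)
  let R := (r : ZMod n).val
  have hR : (R : ZMod n) = r := ZMod.natCast_zmod_val _
  have hRodd : (R : ZMod 2) = 1 := ZMod.natCast_eq_one_iff_odd.2
    (Nat.coprime_two_right.1 ((ZMod.val_coe_unit_coprime r).coprime_dvd_right hn))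
  refine nonempty_addEquiv_of_same_kernel (p.comp (inflation hopen)) (invariants n r R (ZMod 2))
    (fun x => ?_) (fun x => ?_) fun c => ?_
  · obtain ⟨c, rfl⟩ := hp x
    obtain ⟨c₀, b, hc₀, h⟩ := exists_eq_inflation_add_coboundary hπ hN c.2
    refine ⟨⟨c₀, hc₀⟩, ?_⟩
    rw [AddMonoidHom.comp_apply, eq_comm, ← sub_eq_zero, ← map_sub, hp']
    refine ⟨b, fun g k => ?_⟩
    change c.1 (g, k) - c₀ (π g) (π k) = _
    rw [h, add_sub_cancel_left]
  · obtain ⟨c, hc, h1, h2⟩ := exists_cocycle (r := r) hn hn0 R x.1 x.2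
    exact ⟨⟨c, hc⟩, Prod.ext h1 h2⟩
  · have h1 : p (inflation hopen c) = 0 ↔ IsTwoCoboundary c.1 := by
      rw [hp']
      constructor
      · rintro ⟨b, hb⟩
        exact isTwoCoboundary_of_inflation hπ hN zmodTwo_noSmallSubgroups c.2
          (fun _ _ => by rw [nsmul_eq_mul, show ((2 : ℕ) : ZMod 2) = 0 from rfl, zero_mul]) b hb
      · rintro ⟨b, hb⟩
        refine ⟨⟨fun g => b (π g), continuous_comp_of_isOpen_ker hopen b⟩, fun g h => ?_⟩
        change c.1 (π g) (π h) = b (π g) + b (π h) - b (π (g * h))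
        rw [hb, map_mul]
    have hn2 : (n : ZMod 2) = 0 := (ZMod.natCast_eq_zero_iff n 2).2 hn
    rw [AddMonoidHom.comp_apply, h1, isTwoCoboundary_iff c.2 hR]
    -- Since n is even and R odd, changing lifts has no effect modulo 2.
    simp only [nsmul_eq_mul, hn2, hRodd, zero_mul, one_mul, sub_self, exists_const]
    exact (Prod.ext_iff (x := invariants n r R (ZMod 2) c) (y := 0)).symm

/-- Two-torsion in the second cohomology with coefficients `ℂˣ` of an extension of
`CyclicByInt n r` by a compact open subgroup of pro-odd order. -/
theorem nonempty_contH2_complexUnits_torsion_addEquiv (hπ : Function.Surjective π)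
    (hopen : IsOpen (π.ker : Set G)) [CompactSpace π.ker] (hN : HasOddIndexBasis π.ker)
    (hn : 2 ∣ n) (hn0 : n ≠ 0) :
    Nonempty (AddSubgroup.torsionBy (contH2 G (Additive ℂˣ)) 2 ≃+ ZMod 2) := by
  have : LocallyCompactSpace G := (isCompact_iff_compactSpace.2 ‹CompactSpace π.ker›)
    |>.locallyCompactSpace_of_mem_nhds_of_group (hopen.mem_nhds (one_mem π.ker))
  have : NeZero n := ⟨hn0⟩
  obtain ⟨p, hp, hp'⟩ := exists_contZ2_to_contH2 G (Additive ℂˣ)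
  -- S represents r − 1 modulo n; the added n prevents truncation of the subtraction.
  let S := (r : ZMod n).val + n - 1
  have hS : 1 + S = (r : ZMod n).val + n := by have := Nat.pos_of_ne_zero hn0; omega
  have hR : ((1 + S : ℕ) : ZMod n) = r := by rw [hS]; simp
  obtain ⟨d, n', r', hd, hcop, hnd, hSd⟩ : ∃ d n' r' : ℕ, 0 < d ∧ Nat.Coprime n' r' ∧
      n = d * n' ∧ S = d * r' := by
    obtain ⟨n', r', h1, h2, h3⟩ := Nat.exists_coprime n S
    exact ⟨n.gcd S, n', r', Nat.gcd_pos_of_pos_left _ (Nat.pos_of_ne_zero hn0), h1,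
      by rwa [mul_comm], by rwa [mul_comm]⟩
  -- The functional whose kernel is the line of sign pairs that become trivial over ℂˣ.
  let lam : ZMod 2 × ZMod 2 →+ ZMod 2 :=
    AddMonoidHom.mk' (fun x => x.1 * r' + x.2 * n') fun x y => by
      simp only [Prod.fst_add, Prod.snd_add]; ring
  let f : twoCocycles (CyclicByInt n r) (ZMod 2) →+ contH2 G (Additive ℂˣ) :=
    p.comp ((inflation hopen).comp (twoCocyclesMap signChar))
  have htors (x : contH2 G (Additive ℂˣ)) :
      x ∈ AddSubgroup.torsionBy (contH2 G (Additive ℂˣ)) 2 ↔ x + x = 0 := by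
    have := AddSubgroup.torsionBy.nsmul_iff (A := contH2 G (Additive ℂˣ)) (n := 2) (x := x)
    rwa [two_nsmul] at this
  have hf2 (c) : f c ∈ AddSubgroup.torsionBy (contH2 G (Additive ℂˣ)) 2 := by
    have h0 : c + c = 0 :=
      Subtype.ext (funext fun _ => funext fun _ => CharTwo.add_self_eq_zero _)
    rw [htors, ← map_add, h0, map_zero]
  refine nonempty_addEquiv_of_same_kernel (f.codRestrict _ hf2)
    (lam.comp (invariants n r (1 + S) (ZMod 2))) (fun x => ?_) (fun x => ?_) fun c => ?_
  · obtain ⟨x, hx⟩ := x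
    obtain ⟨c, rfl⟩ := hp x
    rw [htors, ← map_add, hp'] at hx
    obtain ⟨β, hβ⟩ := hx
    obtain ⟨γ, hγ⟩ := exists_continuous_half hopen hN β
    -- Twice `c` is the coboundary of `β`; removing the coboundary of a square root of `β` leaves a
    -- cocycle with values ±1.
    let c' (g h : G) : Additive ℂˣ := c.1 (g, h) - (γ g + γ h - γ (g * h))
    have hc'2 (g h : G) : 2 • c' g h = 0 := by
      have h1 : c.1 (g, h) + c.1 (g, h) = _ := hβ g h
      rw [hγ, hγ, hγ, ← two_nsmul] at h1
      simp only [c', nsmul_sub, nsmul_add, h1, sub_self]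
    have hc' (g h k : G) : c' h k + c' g (h * k) = c' (g * h) k + c' g h := by
      have h1 := c.2 g h k
      simp only [c', mul_assoc]
      rw [← sub_eq_zero] at h1 ⊢
      rw [← h1]
      abel
    choose s hs using fun p : G × G => exists_signChar_eq (hc'2 p.1 p.2)
    have hs_cont : Continuous s := by
      refine continuous_iff_isClosed.2 fun T _ => ?_
      have h1 : s ⁻¹' T = ⋃ t ∈ T, {p : G × G | c' p.1 p.2 = signChar t} := by
        ext p
        simp only [Set.mem_preimage, Set.mem_iUnion, Set.mem_ofPred_eq, exists_prop, ← hs,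
          signChar_injective.eq_iff]
        exact ⟨fun h => ⟨_, h, rfl⟩, fun ⟨t, h, h'⟩ => h' ▸ h⟩
      rw [h1]
      have : T2Space (Additive ℂˣ) := inferInstanceAs (T2Space ℂˣ)
      refine T.toFinite.isClosed_biUnion fun t _ => isClosed_eq ?_ continuous_const
      simp only [c']
      fun_prop
    have hsZ : (⟨s, hs_cont⟩ : C(G × G, ZMod 2)) ∈ contZ2 G (ZMod 2) := fun g h k => by
      apply signChar_injective
      change signChar (s _ + s _) = signChar (s _ + s _)
      rw [map_add, map_add, hs, hs, hs, hs]
      exact hc' g h k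
    obtain ⟨c₀, b, hc₀, h⟩ := exists_eq_inflation_add_coboundary hπ hN hsZ
    refine ⟨⟨c₀, hc₀⟩, Subtype.ext ?_⟩
    change p _ = p c
    rw [eq_comm, ← sub_eq_zero, ← map_sub, hp']
    refine ⟨γ + ⟨fun g => signChar (b g), continuous_of_discreteTopology.comp b.continuous⟩,
      fun g k => ?_⟩
    change c.1 (g, k) - signChar (c₀ (π g) (π k)) = (γ g + signChar (b g)) +
      (γ k + signChar (b k)) - (γ (g * k) + signChar (b (g * k)))
    have h1 : signChar (c₀ (π g) (π k)) =
        c' g k - (signChar (b g) + signChar (b k) - signChar (b (g * k))) := by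
      rw [← hs (g, k), show s (g, k) = _ from h g k]
      simp only [map_add, map_sub]
      abel
    rw [h1]
    simp only [c']
    abel
  · have key : ∀ N R x : ZMod 2, (N ≠ 0 ∨ R ≠ 0) → ∃ a b, a * R + b * N = x := by decide
    obtain ⟨a, b, hab⟩ := key n' r' x (ne_zero_or_ne_zero_of_coprime hcop)
    obtain ⟨c, hc, h1, h2⟩ := exists_cocycle (r := r) hn hn0 (1 + S) a b
    refine ⟨⟨c, hc⟩, ?_⟩
    change torsionInvariant n r c * r' + commutatorInvariant n r (1 + S) c * n' = x
    rw [h1, h2, hab]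
  · have h1 : f c = 0 ↔ IsTwoCoboundary (twoCocyclesMap signChar c).1 := by
      rw [AddMonoidHom.comp_apply, hp']
      constructor
      · rintro ⟨b, hb⟩
        exact isTwoCoboundary_of_inflation hπ hN complexUnits_noSmallSubgroups
          (twoCocyclesMap signChar c).2 (fun _ _ => two_nsmul_signChar _) b hb
      · rintro ⟨b, hb⟩
        refine ⟨⟨fun g => b (π g), continuous_comp_of_isOpen_ker hopen b⟩, fun g h => ?_⟩
        change (twoCocyclesMap signChar c).1 (π g) (π h) = b (π g) + b (π h) - b (π (g * h))
        rw [hb, map_mul]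
    have h2 : f.codRestrict _ hf2 c = 0 ↔ f c = 0 := Subtype.ext_iff
    rw [h2, h1, isTwoCoboundary_iff (twoCocyclesMap signChar c).2 hR]
    change (∃ z, torsionInvariant n r (fun g h => signChar (c.1 g h)) = _ ∧
      commutatorInvariant n r (1 + S) (fun g h => signChar (c.1 g h)) = _) ↔ _
    rw [torsionInvariant_comp, commutatorInvariant_comp]
    have h3 := exists_signChar_eq_nsmul_iff hd hcop (torsionInvariant n r c.1)
      (commutatorInvariant n r (1 + S) c.1)
    rw [← hnd, ← hSd] at h3
    exact h3

end Computation

/-! ### Units of a discretely valued division ring -/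

/-- An extension of `ℤ` by a group with a cyclic quotient of order `n` maps onto some
`CyclicByInt n r`. -/
theorem exists_hom_cyclicByInt {G : Type*} [Group G] {n : ℕ} {v : G →* Multiplicative ℤ}
    (hv : Function.Surjective v) {l : v.ker →* Multiplicative (ZMod n)}
    (hl : Function.Surjective l) (hconj : ∀ g k, l k = 1 → l (MulAut.conjNormal g k) = 1) :
    ∃ (r : (ZMod n)ˣ) (π : G →* CyclicByInt n r), Function.Surjective π ∧
      ∀ g, g ∈ π.ker ↔ ∃ h : g ∈ v.ker, l ⟨g, h⟩ = 1 := by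
  obtain ⟨ϖ, hϖ⟩ := hv (Multiplicative.ofAdd 1)
  obtain ⟨ζ, hζ⟩ := hl (Multiplicative.ofAdd 1)
  let L (k : v.ker) : ZMod n := (l k).toAdd
  have L_mul (k k' : v.ker) : L (k * k') = L k + L k' := by simp [L]
  have L_zpow (k : v.ker) (m : ℤ) : L (k ^ m) = m * L k := by simp [L]
  have Lζ : L ζ = 1 := by simp [L, hζ]
  -- Conjugation preserves the kernel of `l`, so it acts on the cyclic quotient through
  -- multiplication by the image of the generator.
  have hL (g : G) (k : v.ker) :
      L (MulAut.conjNormal g k) = L (MulAut.conjNormal g ζ) * L k := by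
    obtain ⟨m, hm⟩ := ZMod.intCast_surjective (L k)
    have h1 : L (ζ ^ (-m) * k) = 0 := by
      rw [L_mul, L_zpow, Lζ, ← hm]; push_cast; ring
    have h2 : L (MulAut.conjNormal g (ζ ^ (-m) * k)) = 0 := hconj g _ h1
    rw [map_mul, map_zpow, L_mul, L_zpow, ← sub_eq_zero] at h2
    rw [← sub_eq_zero, ← h2, ← hm]
    push_cast
    ring
  let r : (ZMod n)ˣ := ⟨L (MulAut.conjNormal ϖ ζ), L (MulAut.conjNormal ϖ⁻¹ ζ), by
    rw [← hL, ← MulAut.mul_apply, ← map_mul, mul_inv_cancel, map_one, MulAut.one_apply, Lζ], by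
    rw [← hL, ← MulAut.mul_apply, ← map_mul, inv_mul_cancel, map_one, MulAut.one_apply, Lζ]⟩
  have hr (s : ℤ) : ∀ k, L (MulAut.conjNormal (ϖ ^ s) k) = ↑(r ^ s) * L k := by
    induction s using Int.induction_on with
    | zero => simp
    | succ s ih =>
      intro k
      rw [zpow_add_one, zpow_add_one, map_mul, MulAut.mul_apply, ih, hL, Units.val_mul, mul_assoc]
    | pred s ih =>
      intro k
      rw [zpow_sub_one, zpow_sub_one, map_mul, MulAut.mul_apply, ih, hL, Units.val_mul, mul_assoc]
      rfl
  have hmem (g : G) : g * ϖ ^ (-(v g).toAdd) ∈ v.ker := by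
    rw [MonoidHom.mem_ker, map_mul, map_zpow, hϖ, ← ofAdd_zsmul]
    simp
  let π : G →* CyclicByInt n r :=
    MonoidHom.mk' (fun g => ⟨L ⟨_, hmem g⟩, (v g).toAdd⟩) fun g h => by
      ext
      · simp only [CyclicByInt.mul_e]
        rw [← hr, ← L_mul]
        congr 1
        apply Subtype.ext
        simp only [map_mul, toAdd_mul, Subgroup.coe_mul, MulAut.conjNormal_apply, neg_add_rev,
          zpow_add, zpow_neg]
        group
      · simp
  refine ⟨r, π, fun q => ?_, fun g => ?_⟩
  · obtain ⟨k, hk⟩ := hl (Multiplicative.ofAdd q.e)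
    have hvk : v (k * ϖ ^ q.v) = Multiplicative.ofAdd q.v := by
      rw [map_mul, show v (k : G) = 1 from k.2, map_zpow, hϖ, ← ofAdd_zsmul]
      simp
    refine ⟨k * ϖ ^ q.v, CyclicByInt.ext ?_ ?_⟩
    · change (l _).toAdd = q.e
      have : (⟨_, hmem (k * ϖ ^ q.v)⟩ : v.ker) = k := by
        apply Subtype.ext
        simp [hvk]
      rw [this, hk, toAdd_ofAdd]
    · change (v _).toAdd = q.v
      rw [hvk, toAdd_ofAdd]
  · rw [MonoidHom.mem_ker, CyclicByInt.ext_iff]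
    change L ⟨_, hmem g⟩ = 0 ∧ (v g).toAdd = 0 ↔ _
    constructor
    · rintro ⟨h1, h2⟩
      refine ⟨h2, ?_⟩
      have : (⟨_, hmem g⟩ : v.ker) = ⟨g, h2⟩ := Subtype.ext (by simp [h2])
      rw [this] at h1
      exact h1
    · rintro ⟨h1, h2⟩
      rw [MonoidHom.mem_ker] at h1
      have h3 : (⟨_, hmem g⟩ : v.ker) = ⟨g, h1⟩ := Subtype.ext (by simp [h1])
      exact ⟨by rw [h3]; exact h2, by simp [h1]⟩

section ValuedDivisionRing

variable {D : Type*} [DivisionRing D] {Γ : Type*} [LinearOrderedCommGroupWithZero Γ]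
  (W : Valuation D Γ)

/-- The normalised valuation on the units of a division ring with cyclic value group. -/
theorem exists_normalized_valuation [IsCyclic Γˣ] (hnt : ∃ x : D, x ≠ 0 ∧ W x ≠ 1) :
    ∃ v : Dˣ →* Multiplicative ℤ, Function.Surjective v ∧ ∀ g, g ∈ v.ker ↔ W g = 1 := by
  let w : Dˣ →* Γˣ := Units.map W.toMonoidWithZeroHom.toMonoidHom
  have hw (g : Dˣ) : (w g : Γ) = W g := rfl
  have : Nontrivial w.range := by
    obtain ⟨x, hx, hx1⟩ := hnt
    refine ⟨⟨w (Units.mk0 x hx), ⟨_, rfl⟩⟩, 1, fun h => hx1 ?_⟩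
    exact congrArg Units.val (Subtype.ext_iff.1 h)
  -- A nontrivial linearly ordered group is infinite, so this cyclic group is ℤ.
  have : Infinite w.range := inferInstance
  let e : Multiplicative ℤ ≃* w.range := intCyclicMulEquiv
  refine ⟨e.symm.toMonoidHom.comp w.rangeRestrict,
    e.symm.surjective.comp w.rangeRestrict_surjective, fun g => ?_⟩
  rw [MonoidHom.mem_ker]
  change e.symm (w.rangeRestrict g) = 1 ↔ _
  rw [map_eq_one_iff _ e.symm.injective, Subtype.ext_iff, ← hw, Units.val_eq_one]
  rfl

/-- The maximal ideal of the valuation ring of a division ring. -/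
def maxIdeal : Ideal W.integer where
  carrier := {x | W x < 1}
  zero_mem' := by simp
  add_mem' {x y} hx hy := W.map_add_lt hx hy
  smul_mem' x y hy := by
    change W (x * y) < 1
    rw [map_mul]
    exact mul_lt_one_of_nonneg_of_lt_one_right x.2 zero_le hy

theorem mem_maxIdeal (x : W.integer) : x ∈ maxIdeal W ↔ W x < 1 := Iff.rfl

instance : (maxIdeal W).IsTwoSided where
  mul_mem_of_left {x} y hx := by
    rw [mem_maxIdeal] at hx ⊢
    change W (x * y) < 1
    rw [map_mul]
    exact mul_lt_one_of_lt_of_le hx y.2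

/-- The residue ring of the valuation ring of a division ring. -/
abbrev ResidueRing : Type _ := W.integer ⧸ maxIdeal W

instance : IsDomain (ResidueRing W) := by
  have : Nontrivial (ResidueRing W) := Ideal.Quotient.nontrivial_iff.2 fun h => by
    have := (Ideal.eq_top_iff_one _).1 h
    rw [mem_maxIdeal] at this
    simp at this
  have : NoZeroDivisors (ResidueRing W) := ⟨fun {a b} h => by
    obtain ⟨a, rfl⟩ := Ideal.Quotient.mk_surjective a
    obtain ⟨b, rfl⟩ := Ideal.Quotient.mk_surjective b
    rw [← map_mul, Ideal.Quotient.eq_zero_iff_mem, mem_maxIdeal] at h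
    rw [Ideal.Quotient.eq_zero_iff_mem, Ideal.Quotient.eq_zero_iff_mem, mem_maxIdeal, mem_maxIdeal]
    by_contra! hab
    refine h.not_ge ?_
    change 1 ≤ W (a * b)
    rw [map_mul]
    exact one_le_mul hab.1 hab.2⟩
  exact NoZeroDivisors.to_isDomain _

/-- Wedderburn's little theorem makes the ring a field, whose finite unit group is cyclic. -/
theorem isCyclic_units_of_finite_isDomain (R : Type*) [Ring R] [IsDomain R] [Finite R] :
    IsCyclic Rˣ := by
  have h := Finite.isDomain_to_isField R
  let : CommRing R := { ‹Ring R› with mul_comm := h.mul_comm }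
  exact isCyclic_of_injective_ringHom (Units.coeHom R) Units.val_injective

/-- Reduction of the units of the valuation ring modulo the maximal ideal. -/
theorem exists_reduction {K : Subgroup Dˣ} (hK : ∀ g, g ∈ K ↔ W g = 1) :
    ∃ f : K →* (ResidueRing W)ˣ, Function.Surjective f ∧
      ∀ k, f k = 1 ↔ W ((k : Dˣ) - 1 : D) < 1 := by
  have hinv (g : Dˣ) (hg : W g = 1) : W (↑g⁻¹ : D) = 1 := by
    have : W g * W (↑g⁻¹ : D) = 1 := by rw [← map_mul, Units.mul_inv, map_one]
    rwa [hg, one_mul] at this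
  let f₀ : K →* (W.integer)ˣ :=
    { toFun k := ⟨⟨k.1, ((hK _).1 k.2).le⟩, ⟨↑k.1⁻¹, (hinv _ ((hK _).1 k.2)).le⟩,
        Subtype.ext k.1.mul_inv, Subtype.ext k.1.inv_mul⟩
      map_one' := rfl
      map_mul' _ _ := rfl }
  refine ⟨(Units.map (Ideal.Quotient.mk (maxIdeal W)).toMonoidHom).comp f₀, fun u => ?_,
    fun k => ?_⟩
  · obtain ⟨x, hx⟩ := Ideal.Quotient.mk_surjective (u : ResidueRing W)
    have hx1 : W x = 1 := by
      refine le_antisymm x.2 (not_lt.1 fun h => u.ne_zero ?_)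
      rw [← hx, Ideal.Quotient.eq_zero_iff_mem, mem_maxIdeal]
      exact h
    have hx0 : (x : D) ≠ 0 := by
      intro h
      rw [h, map_zero] at hx1
      exact zero_ne_one hx1
    exact ⟨⟨Units.mk0 x hx0, (hK _).2 hx1⟩, Units.ext hx⟩
  · rw [Units.ext_iff]
    change Ideal.Quotient.mk (maxIdeal W) ⟨k.1, _⟩ = Ideal.Quotient.mk (maxIdeal W) 1 ↔ _
    rw [Ideal.Quotient.mk_eq_mk_iff_sub_mem, mem_maxIdeal]
    rfl

theorem two_dvd_card_units_residueRing (h2 : W 2 = 1) [Finite (ResidueRing W)] :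
    2 ∣ Nat.card (ResidueRing W)ˣ := by
  have h : orderOf (-1 : (ResidueRing W)ˣ) = 2 := by
    refine orderOf_eq_prime (by simp) fun h => ?_
    have h1 : (-1 : ResidueRing W) = 1 := congrArg Units.val h
    have h3 : Ideal.Quotient.mk (maxIdeal W) 2 = 0 := by
      rw [← one_add_one_eq_two, map_add, map_one]
      nth_rewrite 1 [← h1]
      exact neg_add_cancel _
    rw [Ideal.Quotient.eq_zero_iff_mem, mem_maxIdeal] at h3
    exact h3.ne h2
  rw [← h]
  exact orderOf_dvd_natCard _

theorem valuation_eq_one_of_mem {W : Valuation D Γ} {N : Subgroup Dˣ}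
    (hN : ∀ g, g ∈ N ↔ W ((g : D) - 1) < 1) {g : Dˣ} (hg : g ∈ N) : W g = 1 := by
  have h1 := W.map_add_eq_of_lt_right (x := (g : D) - 1) (y := 1) (by simpa using (hN g).1 hg)
  simpa using h1

variable [TopologicalSpace D] [IsTopologicalRing D]

theorem finite_residueRing (hopen : ∀ γ, γ ≠ 0 → IsOpen {x | W x < γ})
    (hcomp : IsCompact {x | W x ≤ 1}) : Finite (ResidueRing W) := by
  have : CompactSpace W.integer := isCompact_iff_compactSpace.1 hcomp
  exact AddSubgroup.quotient_finite_of_isOpen (maxIdeal W).toAddSubgroup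
    ((hopen 1 one_ne_zero).preimage continuous_subtype_val)

section PrincipalUnits

variable {W} {N : Subgroup Dˣ}

theorem isOpen_principalUnits (hN : ∀ g, g ∈ N ↔ W ((g : D) - 1) < 1)
    (hopen : ∀ γ, γ ≠ 0 → IsOpen {x | W x < γ}) :
    IsOpen (N : Set Dˣ) := by
  have : (N : Set Dˣ) = (fun g : Dˣ => (g : D) - 1) ⁻¹' {x | W x < 1} := Set.ext hN
  rw [this]
  exact (hopen 1 one_ne_zero).preimage (Units.continuous_val.sub continuous_const)

/-- The units are closed in D × Dᵐᵒᵖ, and a principal unit and its inverse both lie in the compact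
valuation ring. -/
theorem compactSpace_principalUnits [T2Space D]
    (hN : ∀ g, g ∈ N ↔ W ((g : D) - 1) < 1) (hopen : ∀ γ, γ ≠ 0 → IsOpen {x | W x < γ})
    (hcomp : IsCompact {x | W x ≤ 1}) : CompactSpace N := by
  suffices IsCompact (N : Set Dˣ) from isCompact_iff_compactSpace.1 this
  have h1 : IsCompact ({x : D | W x ≤ 1} ×ˢ (MulOpposite.op '' {x : D | W x ≤ 1})) :=
    hcomp.prod (hcomp.image MulOpposite.continuous_op)
  have h2 := (Units.isClosedEmbedding_embedProduct (α := D)).isCompact_preimage h1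
  refine h2.of_isClosed_subset (N.isClosed_of_isOpen (isOpen_principalUnits hN hopen)) ?_
  intro g hg
  exact ⟨(valuation_eq_one_of_mem hN hg).le,
    ⟨_, (valuation_eq_one_of_mem hN (inv_mem hg)).le, rfl⟩⟩

/-- For g in `N`, g + 1 = (g − 1) + 2 has valuation 1, so g² − 1 = (g − 1)(g + 1) is exactly as
small as g − 1. The quotient by a smaller congruence subgroup thus has no element of order 2, and
Cauchy's theorem makes its order odd. -/
theorem hasOddIndexBasis_principalUnits [CompactSpace N]
    (hN : ∀ g, g ∈ N ↔ W ((g : D) - 1) < 1)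
    (hopen : ∀ γ, γ ≠ 0 → IsOpen {x | W x < γ})
    (hbasis : ∀ U ∈ 𝓝 (0 : D), ∃ γ, γ ≠ 0 ∧ {x | W x < γ} ⊆ U) (h2 : W 2 = 1) :
    HasOddIndexBasis N := by
  intro U hU
  have hone (g : N) : W (g : Dˣ) = 1 := valuation_eq_one_of_mem hN g.2
  have hmul (g h : N) : (((g * h : N) : Dˣ) : D) - 1 =
      (((g : Dˣ) : D) - 1) * (h : Dˣ) + (((h : Dˣ) : D) - 1) := by
    push_cast; noncomm_ring
  have hinv (g : N) : W ((((g⁻¹ : N) : Dˣ) : D) - 1) = W (((g : Dˣ) : D) - 1) := by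
    have : (((g⁻¹ : N) : Dˣ) : D) - 1 = -((((g⁻¹ : N) : Dˣ) : D) * (((g : Dˣ) : D) - 1)) := by
      rw [mul_sub, mul_one, neg_sub, ← Units.val_mul, ← Subgroup.coe_mul, inv_mul_cancel]
      simp
    rw [this, Valuation.map_neg, map_mul, hone, one_mul]
  obtain ⟨γ, hγ, hγU⟩ : ∃ γ, γ ≠ 0 ∧ ∀ g : N, W (((g : Dˣ) : D) - 1) < γ → g ∈ U := by
    obtain ⟨U', hU', hU'U⟩ := mem_nhds_subtype _ _ _ |>.1 hU
    rw [Units.isInducing_embedProduct.nhds_eq_comap] at hU'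
    obtain ⟨T, hT, hTU⟩ := hU'
    obtain ⟨A, hA, B, hB, hAB⟩ := mem_nhds_prod_iff.1 hT
    have hA' : (fun x : D => x + 1) ⁻¹' A ∈ 𝓝 (0 : D) :=
      (continuous_add_const (1 : D)).continuousAt (by simpa using hA)
    have hB' : (fun x : D => MulOpposite.op (x + 1)) ⁻¹' B ∈ 𝓝 (0 : D) :=
      (MulOpposite.continuous_op.comp (continuous_add_const (1 : D))).continuousAt
        (by simpa using hB)
    obtain ⟨γ, hγ, hγU⟩ := hbasis _ (inter_mem hA' hB')
    refine ⟨γ, hγ, fun g hg => hU'U (hTU (hAB ⟨?_, ?_⟩))⟩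
    · simpa using (hγU hg).1
    · have := (hγU (show W ((((g⁻¹ : N) : Dˣ) : D) - 1) < γ by rwa [hinv])).2
      simpa using this
  let V : Subgroup N :=
    { carrier := {g | W (((g : Dˣ) : D) - 1) < γ}
      one_mem' := by simpa using zero_lt_iff.2 hγ
      mul_mem' {g h} hg hh := by
        rw [Set.mem_ofPred_eq, hmul]
        exact W.map_add_lt (by rwa [map_mul, hone, mul_one]) hh
      inv_mem' {g} hg := by
        rw [Set.mem_ofPred_eq, hinv]
        exact hg }
  have hV (g : N) : g ∈ V ↔ W (((g : Dˣ) : D) - 1) < γ := Iff.rfl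
  have hVn : V.Normal := ⟨fun g hg k => by
    rw [hV] at hg ⊢
    have : (((k * g * k⁻¹ : N) : Dˣ) : D) - 1 =
        ((k : Dˣ) : D) * (((g : Dˣ) : D) - 1) * (((k⁻¹ : N) : Dˣ) : D) := by
      rw [mul_sub, sub_mul, mul_one]
      push_cast
      rw [mul_inv_cancel₀ (Units.ne_zero _)]
    rwa [this, map_mul, map_mul, hone, hone, one_mul, mul_one]⟩
  have hVo : IsOpen (V : Set N) := by
    have : (V : Set N) = (fun g : N => ((g : Dˣ) : D) - 1) ⁻¹' {x | W x < γ} := rfl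
    rw [this]
    exact (hopen γ hγ).preimage
      ((Units.continuous_val.comp continuous_subtype_val).sub continuous_const)
  refine ⟨V, hVn, hVo, ?_, fun g hg => hγU g hg⟩
  have : Finite (N ⧸ V) := V.quotient_finite_of_isOpen hVo
  rw [← Nat.not_even_iff_odd]
  intro heven
  have : Fact (Nat.Prime 2) := ⟨Nat.prime_two⟩
  obtain ⟨q, hq⟩ := exists_prime_orderOf_dvd_card' (G := N ⧸ V) 2 heven.two_dvd
  obtain ⟨g, rfl⟩ := QuotientGroup.mk_surjective q
  have h1 : (g ^ 2 : N) ∈ V := by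
    rw [← QuotientGroup.eq_one_iff, QuotientGroup.mk_pow, ← hq, pow_orderOf_eq_one]
  have h3 : g ∈ V := by
    rw [hV] at h1 ⊢
    have h4 : W (((g : Dˣ) : D) + 1) = 1 := by
      have := W.map_add_eq_of_lt_right (x := ((g : Dˣ) : D) - 1) (y := 2)
        (by rw [h2]; exact (hN g).1 g.2)
      rw [h2] at this
      rw [← this]
      congr 1
      rw [← one_add_one_eq_two]
      abel
    have h5 : (((g ^ 2 : N) : Dˣ) : D) - 1 = (((g : Dˣ) : D) - 1) * (((g : Dˣ) : D) + 1) := by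
      push_cast; noncomm_ring
    rwa [h5, map_mul, h4, mul_one] at h1
  rw [(QuotientGroup.eq_one_iff g).2 h3, orderOf_one] at hq
  norm_num at hq

end PrincipalUnits

/-- The unit group of a division ring with a discrete valuation, compact valuation ring and odd
residue characteristic is an extension of some `CyclicByInt n r` by a compact open group of
pro-odd order. -/
theorem exists_units_hom_cyclicByInt [T2Space D] [IsCyclic Γˣ]
    (hnt : ∃ x : D, x ≠ 0 ∧ W x ≠ 1) (hopen : ∀ γ, γ ≠ 0 → IsOpen {x | W x < γ})
    (hbasis : ∀ U ∈ 𝓝 (0 : D), ∃ γ, γ ≠ 0 ∧ {x | W x < γ} ⊆ U)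
    (hcomp : IsCompact {x | W x ≤ 1}) (h2 : W 2 = 1) :
    ∃ (n : ℕ) (r : (ZMod n)ˣ) (π : Dˣ →* CyclicByInt n r), Function.Surjective π ∧
      IsOpen (π.ker : Set Dˣ) ∧ CompactSpace π.ker ∧ HasOddIndexBasis π.ker ∧ 2 ∣ n ∧ n ≠ 0 := by
  obtain ⟨v, hv, hvker⟩ := exists_normalized_valuation W hnt
  obtain ⟨f, hf, hfker⟩ := exists_reduction W hvker
  have := finite_residueRing W hopen hcomp
  have hcyc := isCyclic_units_of_finite_isDomain (ResidueRing W)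
  let e := zmodCyclicMulEquiv hcyc
  obtain ⟨r, π, hπ, hπker⟩ := exists_hom_cyclicByInt hv (l := e.symm.toMonoidHom.comp f)
    (e.symm.surjective.comp hf) (fun g k hk => by
      have h1 : f k = 1 := e.symm.injective (hk.trans (map_one e.symm).symm)
      have h3 : f (MulAut.conjNormal g k) = 1 := by
        rw [hfker] at h1 ⊢
        rw [MulAut.conjNormal_apply]
        have : ((g * k * g⁻¹ : Dˣ) : D) - 1 = g * ((k : Dˣ) - 1) * (↑g⁻¹ : D) := by
          rw [mul_sub, sub_mul, mul_one, Units.mul_inv]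
          push_cast
          rfl
        rw [this, map_mul, map_mul, mul_right_comm, ← map_mul, Units.mul_inv, map_one, one_mul]
        exact h1
      change e.symm (f _) = 1
      rw [h3, map_one])
  have hN (g : Dˣ) : g ∈ π.ker ↔ W ((g : D) - 1) < 1 := by
    rw [hπker]
    have h1 (h : g ∈ v.ker) : e.symm.toMonoidHom.comp f ⟨g, h⟩ = 1 ↔ W ((g : D) - 1) < 1 := by
      rw [← hfker ⟨g, h⟩]
      exact map_eq_one_iff e.symm e.symm.injective
    refine ⟨fun ⟨h, h'⟩ => (h1 h).1 h', fun h => ?_⟩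
    have h3 := W.map_add_eq_of_lt_right (x := (g : D) - 1) (y := 1) (by simpa using h)
    have h4 : g ∈ v.ker := by
      rw [hvker]
      simpa using h3
    exact ⟨h4, (h1 h4).2 h⟩
  have hc := compactSpace_principalUnits hN hopen hcomp
  exact ⟨_, r, π, hπ, isOpen_principalUnits hN hopen, hc,
    hasOddIndexBasis_principalUnits hN hopen hbasis h2, two_dvd_card_units_residueRing W h2,
    Nat.card_pos.ne'⟩

end ValuedDivisionRing

/-! ### The norm valuation on a division algebra over a local field -/

section LocalDivisionAlgebra

open ValuativeRel

section NormVal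

variable (F : Type*) [Field F] [ValuativeRel F] (D : Type*) [DivisionRing D] [Algebra F D]
  [Module.Finite F D]

/-- The composition of the norm of a finite-dimensional division algebra with the valuation. -/
noncomputable def normVal : D →*₀ ValueGroupWithZero F where
  toFun x := valuation F (Algebra.norm F x)
  map_zero' := by rw [Algebra.norm_zero, map_zero]
  map_one' := by rw [map_one, map_one]
  map_mul' x y := by rw [map_mul, map_mul]

variable {D}

theorem normVal_smul (c : F) (x : D) :
    normVal F D (c • x) = valuation F c ^ Module.finrank F D * normVal F D x := by
  rw [Algebra.smul_def, map_mul]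
  congr 1
  change valuation F (Algebra.norm F _) = _
  rw [Algebra.norm_algebraMap, map_pow]

end NormVal

variable {F : Type*} [Field F] [ValuativeRel F] [TopologicalSpace F] [IsNonarchimedeanLocalField F]

theorem isOpen_valuation_le {γ : ValueGroupWithZero F} (hγ : γ ≠ 0) :
    IsOpen {x : F | valuation F x ≤ γ} := by
  obtain ⟨y, rfl⟩ := valuation_surjective γ
  simp_rw [← (valuation F).restrict_le_iff]
  exact Valuation.isOpen_closedBall (by simpa using hγ)

theorem isClosed_valuation_le (γ : ValueGroupWithZero F) :
    IsClosed {x : F | valuation F x ≤ γ} := by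
  obtain ⟨y, rfl⟩ := valuation_surjective γ
  simp_rw [← (valuation F).restrict_le_iff]
  exact Valuation.isClosed_closedBall _

theorem isOpen_valuation_lt (γ : ValueGroupWithZero F) :
    IsOpen {x : F | valuation F x < γ} := by
  obtain ⟨y, rfl⟩ := valuation_surjective γ
  simp_rw [← (valuation F).restrict_lt_iff]
  exact Valuation.isOpen_ball _

variable (F) in
theorem IsNonarchimedeanLocalField.t2Space : T2Space F :=
  IsTopologicalAddGroup.t2Space_of_zero_sep fun x hx =>
    ⟨{y | valuation F y < valuation F x}, (isOpen_valuation_lt _).mem_nhds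
      (by simpa [zero_lt_iff] using hx), fun h => lt_irrefl (valuation F x) h⟩

theorem valuation_two_eq_one (hodd : Odd (ringChar 𝓀[F])) : valuation F 2 = 1 := by
  have h2 : (2 : 𝓀[F]) ≠ 0 := by
    intro h
    have h1 : ringChar 𝓀[F] ∣ 2 := (ringChar.spec 𝓀[F] 2).1 (by exact_mod_cast h)
    rcases (Nat.dvd_prime Nat.prime_two).1 h1 with h3 | h3
    · exact CharP.ringChar_ne_one h3
    · rw [h3] at hodd
      exact absurd hodd (by decide)
  have h3 : IsUnit (2 : 𝒪[F]) := by
    rw [← IsLocalRing.residue_ne_zero_iff_isUnit, map_ofNat]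
    exact h2
  have h4 := (Valuation.integer.integers (valuation F)).isUnit_iff_valuation_eq_one.1 h3
  rwa [map_ofNat] at h4

theorem exists_valuation_pow_lt {a : F} (ha : valuation F a < 1) {γ : ValueGroupWithZero F}
    (hγ : γ ≠ 0) : ∃ k : ℕ, valuation F a ^ k < γ :=
  exists_pow_lt₀ ha (Units.mk0 γ hγ)

theorem tendsto_pow_nhds_zero_of_valuation_lt_one {a : F} (ha : valuation F a < 1) :
    Tendsto (fun k : ℕ => a ^ k) atTop (𝓝 0) := by
  rw [(IsValuativeTopology.hasBasis_nhds_zero' F).tendsto_right_iff]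
  intro γ hγ
  obtain ⟨k, hk⟩ := exists_valuation_pow_lt ha hγ
  filter_upwards [eventually_ge_atTop k] with j hj
  rw [map_pow]
  exact (pow_le_pow_right_of_le_one' ha.le hj).trans_lt hk

variable (F) {D : Type*} [DivisionRing D] [Algebra F D] [Module.Finite F D]
  [TopologicalSpace D] [IsModuleTopology F D]

theorem continuous_norm_of_isModuleTopology : Continuous (Algebra.norm F : D → F) := by
  have h1 : Continuous (Algebra.leftMulMatrix (Module.finBasis F D)) :=
    IsModuleTopology.continuous_of_linearMap
      (Algebra.leftMulMatrix (Module.finBasis F D)).toLinearMap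
  have h2 := h1.matrix_det
  convert h2 using 1
  funext x
  exact Algebra.norm_eq_matrix_det _ x

theorem isOpen_normVal_lt (γ : ValueGroupWithZero F) : IsOpen {x : D | normVal F D x < γ} :=
  (isOpen_valuation_lt γ).preimage (continuous_norm_of_isModuleTopology F)

theorem isOpen_normVal_le {γ : ValueGroupWithZero F} (hγ : γ ≠ 0) :
    IsOpen {x : D | normVal F D x ≤ γ} :=
  (isOpen_valuation_le hγ).preimage (continuous_norm_of_isModuleTopology F)

theorem isClosed_normVal_le (γ : ValueGroupWithZero F) : IsClosed {x : D | normVal F D x ≤ γ} :=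
  (isClosed_valuation_le γ).preimage (continuous_norm_of_isModuleTopology F)

/-- The norm vanishes only at 0, so the image of `K` is a compact set missing 0. -/
theorem exists_le_normVal {K : Set D} (hK : IsCompact K) (h0 : (0 : D) ∉ K) :
    ∃ γ, γ ≠ 0 ∧ ∀ x ∈ K, γ ≤ normVal F D x := by
  have := IsNonarchimedeanLocalField.t2Space F
  have h1 : IsCompact (Algebra.norm F '' K) := hK.image (continuous_norm_of_isModuleTopology F)
  have h2 : (Algebra.norm F '' K)ᶜ ∈ 𝓝 (0 : F) := by
    refine h1.isClosed.isOpen_compl.mem_nhds ?_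
    rintro ⟨x, hx, hx0⟩
    have h3 : normVal F D x = 0 := by
      change valuation F _ = 0
      rw [hx0, map_zero]
    rw [map_eq_zero] at h3
    exact h0 (h3 ▸ hx)
  obtain ⟨γ, hγ, hγK⟩ := (IsValuativeTopology.hasBasis_nhds_zero' F).mem_iff.1 h2
  exact ⟨γ, hγ, fun x hx => not_lt.1 fun h => hγK h ⟨x, hx, rfl⟩⟩

theorem exists_normVal_le {K : Set D} (hK : IsCompact K) :
    ∃ γ, γ ≠ 0 ∧ ∀ x ∈ K, normVal F D x ≤ γ := by
  refine hK.induction_on (p := fun s => ∃ γ, γ ≠ 0 ∧ ∀ x ∈ s, normVal F D x ≤ γ)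
    ⟨1, one_ne_zero, by simp⟩ (fun s t hst ⟨γ, h0, h⟩ => ⟨γ, h0, fun x hx => h x (hst hx)⟩) ?_ ?_
  · rintro s t ⟨γ, h0, h⟩ ⟨δ, h0', h'⟩
    refine ⟨max γ δ, ((zero_lt_iff.2 h0).trans_le (le_max_left _ _)).ne', ?_⟩
    rintro x (hx | hx)
    exacts [(h x hx).trans (le_max_left _ _), (h' x hx).trans (le_max_right _ _)]
  · intro x _
    have h0 : max (normVal F D x) 1 ≠ 0 := (zero_lt_one.trans_le (le_max_right _ _)).ne'
    exact ⟨_, mem_nhdsWithin_of_mem_nhds ((isOpen_normVal_le F h0).mem_nhds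
      (show normVal F D x ≤ _ from le_max_left _ _)), _, h0, fun y hy => hy⟩

variable [IsTopologicalRing D]

variable (D) in
theorem nonempty_homeomorph_pi :
    ∃ e : D ≃ₜ (Fin (Module.finrank F D) → F), ∀ x y, e (x + y) = e x + e y := by
  let b := (Module.finBasis F D).equivFun
  exact ⟨{ b.toEquiv with
    continuous_toFun := IsModuleTopology.continuous_of_linearMap b.toLinearMap
    continuous_invFun := IsModuleTopology.continuous_of_linearMap b.symm.toLinearMap },
    fun x y => map_add b x y⟩

theorem t2Space_of_isModuleTopology (F D : Type*) [Field F] [ValuativeRel F] [TopologicalSpace F]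
    [IsNonarchimedeanLocalField F] [DivisionRing D] [Algebra F D] [Module.Finite F D]
    [TopologicalSpace D] [IsTopologicalRing D] [IsModuleTopology F D] : T2Space D := by
  have := IsNonarchimedeanLocalField.t2Space F
  obtain ⟨e, -⟩ := nonempty_homeomorph_pi F D
  exact e.isEmbedding.t2Space

/-- A compact open additive subgroup. -/
theorem exists_compact_open_addSubgroup (F D : Type*) [Field F] [ValuativeRel F]
    [TopologicalSpace F] [IsNonarchimedeanLocalField F] [DivisionRing D] [Algebra F D]
    [Module.Finite F D] [TopologicalSpace D] [IsTopologicalRing D] [IsModuleTopology F D] :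
    ∃ L : AddSubgroup D, IsOpen (L : Set D) ∧ IsCompact (L : Set D) := by
  obtain ⟨e, he⟩ := nonempty_homeomorph_pi F D
  let f : D →+ (Fin (Module.finrank F D) → F) := AddMonoidHom.mk' e he
  let M : AddSubgroup (Fin (Module.finrank F D) → F) :=
    AddSubgroup.pi Set.univ fun _ => (valuation F).integer.toAddSubgroup
  have hM : (M : Set (Fin (Module.finrank F D) → F)) =
      Set.univ.pi fun _ => {x : F | valuation F x ≤ 1} := rfl
  refine ⟨M.comap f, ?_, ?_⟩
  · change IsOpen (e ⁻¹' M)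
    rw [hM]
    exact (isOpen_set_pi Set.finite_univ fun _ _ => isOpen_valuation_le one_ne_zero).preimage
      e.continuous
  · change IsCompact (e ⁻¹' M)
    rw [hM, e.isCompact_preimage]
    exact isCompact_univ_pi fun _ => IsNonarchimedeanLocalField.isCompact_closedBall F 1

/-- Balls of the norm are bounded. -/
theorem exists_smul_mem {L : AddSubgroup D} (hLo : IsOpen (L : Set D))
    (hLc : IsCompact (L : Set D)) (γ : ValueGroupWithZero F) :
    ∃ c : F, c ≠ 0 ∧ ∀ x : D, normVal F D x ≤ γ → c • x ∈ L := by
  have := t2Space_of_isModuleTopology F D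
  obtain ⟨a, ha0, ha⟩ := Valuation.IsNontrivial.exists_lt_one (v := valuation F)
  have hpow (k : ℕ) : valuation F a ^ k ≤ 1 := pow_le_one' ha.le k
  -- Repeated scaling by `a` brings any point into `L`. A point outside `L` passes through `T` just
  -- before entering, and scaling does not increase the norm; the lower bound on `T` therefore puts
  -- all points of small norm in `L`.
  let T : Set D := (fun x => a • x) ⁻¹' L \ L
  have hT : IsCompact T :=
    ((Homeomorph.smulOfNeZero a ha0).isCompact_preimage.2 hLc).diff hLo
  obtain ⟨δ, hδ, hδT⟩ := exists_le_normVal F hT fun h => h.2 L.zero_mem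
  have hsmall (x : D) (hx : normVal F D x < δ) : x ∈ L := by
    by_contra hxL
    have h1 : Tendsto (fun k : ℕ => a ^ k • x) atTop (𝓝 0) := by
      simpa using (tendsto_pow_nhds_zero_of_valuation_lt_one ha).smul_const x
    have h2 : ∃ k : ℕ, a ^ k • x ∈ L := (h1.eventually (hLo.mem_nhds L.zero_mem)).exists
    classical
    obtain ⟨k, hk⟩ : ∃ k, Nat.find h2 = k + 1 :=
      Nat.exists_eq_succ_of_ne_zero fun h => hxL (by simpa [h] using Nat.find_spec h2)
    have h3 : a ^ k • x ∉ L := Nat.find_min h2 (by omega)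
    have h4 : a ^ (k + 1) • x ∈ L := hk ▸ Nat.find_spec h2
    have h5 : a ^ k • x ∈ T := ⟨by rwa [pow_succ', mul_smul] at h4, h3⟩
    have h6 := hδT _ h5
    rw [normVal_smul, map_pow] at h6
    refine (h6.trans ?_).not_gt hx
    calc _ ≤ 1 * normVal F D x := by
          gcongr
          exact pow_le_one' (hpow k) _
      _ = _ := one_mul _
  have hγ' : max γ 1 ≠ 0 := (zero_lt_one.trans_le (le_max_right _ _)).ne'
  obtain ⟨k, hk⟩ := exists_valuation_pow_lt ha (div_ne_zero hδ hγ')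
  refine ⟨a ^ k, pow_ne_zero k ha0, fun x hx => hsmall _ ?_⟩
  rw [normVal_smul, map_pow]
  have h1 : (valuation F a ^ k) ^ Module.finrank F D ≤ valuation F a ^ k :=
    pow_le_of_le_one zero_le (hpow k) Module.finrank_pos.ne'
  calc _ ≤ valuation F a ^ k * max γ 1 := mul_le_mul' h1 (hx.trans (le_max_left _ _))
    _ < δ := (lt_div_iff₀ (zero_lt_iff.2 hγ')).1 hk

theorem isCompact_normVal_le (γ : ValueGroupWithZero F) :
    IsCompact {x : D | normVal F D x ≤ γ} := by
  obtain ⟨L, hLo, hLc⟩ := exists_compact_open_addSubgroup F D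
  obtain ⟨c, hc, h⟩ := exists_smul_mem F hLo hLc γ
  exact ((Homeomorph.smulOfNeZero c hc).isCompact_preimage.2 hLc).of_isClosed_subset
    (isClosed_normVal_le F γ) h

/-- Outside an open neighbourhood of 0, the unit ball is compact and misses 0, so the norm is
bounded below there. -/
theorem exists_normVal_lt_subset {U : Set D} (hU : U ∈ 𝓝 (0 : D)) :
    ∃ γ, γ ≠ 0 ∧ {x | normVal F D x < γ} ⊆ U := by
  obtain ⟨V, hVU, hVo, hV0⟩ := mem_nhds_iff.1 hU
  obtain ⟨γ, hγ, h⟩ := exists_le_normVal F ((isCompact_normVal_le F (D := D) 1).diff hVo)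
    fun h => h.2 hV0
  refine ⟨min γ 1, by simp [min_def]; split_ifs <;> simp [hγ], fun x hx => hVU ?_⟩
  replace hx : normVal F D x < min γ 1 := hx
  by_contra hxV
  have hx1 : normVal F D x ≤ 1 := (hx.trans_le (min_le_right _ _)).le
  exact (h x ⟨hx1, hxV⟩).not_gt (hx.trans_le (min_le_left _ _))

/-- By the binomial formula every power of 1 + x is an integral combination of powers of x, which
lie in one compact additive subgroup after a fixed scaling. The powers of 1 + x are thus bounded,
which is impossible if its norm exceeds 1. -/
theorem normVal_one_add_le {x : D} (hx : normVal F D x ≤ 1) : normVal F D (1 + x) ≤ 1 := by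
  obtain ⟨L, hLo, hLc⟩ := exists_compact_open_addSubgroup F D
  obtain ⟨c, hc, h⟩ := exists_smul_mem F hLo hLc 1
  obtain ⟨B, hB, hBL⟩ := exists_normVal_le F hLc
  have hpow (k : ℕ) : c • (1 + x) ^ k ∈ L := by
    rw [(Commute.one_left x).add_pow, Finset.smul_sum]
    refine L.sum_mem fun i _ => ?_
    rw [one_pow, one_mul, ← nsmul_eq_mul', smul_comm]
    refine L.nsmul_mem (h _ ?_) _
    rw [map_pow]
    exact pow_le_one' hx _
  by_contra! hgt
  have hc0 : valuation F c ^ Module.finrank F D ≠ 0 := pow_ne_zero _ (by simpa using hc)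
  obtain ⟨k, hk⟩ := exists_pow_lt₀ (inv_lt_one_of_one_lt₀ hgt) (Units.mk0 _ (div_ne_zero hc0 hB))
  have h1 := hBL _ (hpow k)
  rw [normVal_smul, map_pow] at h1
  rw [Units.val_mk0, inv_pow, lt_div_iff₀ (zero_lt_iff.2 hB),
    inv_mul_lt_iff₀ (pow_pos (zero_lt_one.trans hgt) k), mul_comm] at hk
  exact hk.not_ge h1

variable (D) in
/-- The valuation of a finite-dimensional division algebra over a local field. -/
noncomputable def divisionValuation : Valuation D (ValueGroupWithZero F) where
  __ := normVal F D
  map_add_le_max' x y := by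
    change normVal F D (x + y) ≤ max (normVal F D x) (normVal F D y)
    wlog hxy : normVal F D x ≤ normVal F D y generalizing x y
    · rw [add_comm, max_comm]
      exact this y x (le_of_not_ge hxy)
    rcases eq_or_ne y 0 with rfl | hy
    · simp
    have h1 : normVal F D (x * y⁻¹) ≤ 1 := by
      rw [map_mul, map_inv₀]
      exact mul_inv_le_one_of_le₀ hxy zero_le
    have h2 : x + y = (1 + x * y⁻¹) * y := by
      rw [add_mul, one_mul, mul_assoc, inv_mul_cancel₀ hy, mul_one, add_comm]
    rw [max_eq_right hxy, h2, map_mul]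
    exact mul_le_of_le_one_left' (normVal_one_add_le F h1)

theorem divisionValuation_apply (x : D) : divisionValuation F D x = normVal F D x := rfl

end LocalDivisionAlgebra

/-! ### Conclusion for the quaternion division algebra -/

theorem proposition4p3
    {F : Type*} [Field F] [ValuativeRel F] [TopologicalSpace F] [IsNonarchimedeanLocalField F]
    (hodd : Odd (ringChar 𝓀[F]))
    {D : Type*} [DivisionRing D] [Algebra F D] [Algebra.IsCentral F D]
    (hdim : Module.finrank F D = 4)
    [TopologicalSpace D] [IsTopologicalRing D] [IsModuleTopology F D] :
    Nonempty (contH2 Dˣ (ZMod 2) ≃+ ZMod 2 × ZMod 2) ∧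
    Nonempty (AddSubgroup.torsionBy (contH2 Dˣ (Additive ℂˣ)) 2 ≃+ ZMod 2) := by
  have : Module.Finite F D := Module.finite_of_finrank_pos (by omega)
  have := t2Space_of_isModuleTopology F D
  have h2 : divisionValuation F D 2 = 1 := by
    have h : (2 : D) = (2 : F) • 1 := by
      rw [Algebra.smul_def, mul_one, map_ofNat]
    rw [divisionValuation_apply, h, normVal_smul, valuation_two_eq_one hodd, one_pow, one_mul,
      map_one]
  have hnt : ∃ x : D, x ≠ 0 ∧ divisionValuation F D x ≠ 1 := by
    obtain ⟨a, ha0, ha⟩ :=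
      Valuation.IsNontrivial.exists_lt_one (v := ValuativeRel.valuation F)
    refine ⟨a • 1, smul_ne_zero ha0 one_ne_zero, ?_⟩
    rw [divisionValuation_apply, normVal_smul, map_one, mul_one]
    exact (pow_lt_one₀ zero_le ha (by omega)).ne
  obtain ⟨n, r, π, hπ, hopen, hcomp, hN, hn, hn0⟩ :=
    exists_units_hom_cyclicByInt (divisionValuation F D) hnt (fun γ _ => isOpen_normVal_lt F γ)
      (fun U hU => exists_normVal_lt_subset F hU) (isCompact_normVal_le F 1) h2
  exact ⟨nonempty_contH2_zmodTwo_addEquiv hπ hopen hN hn hn0,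
    nonempty_contH2_complexUnits_torsion_addEquiv hπ hopen hN hn hn0⟩
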